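/- **Setting.** Let $X$ be a compact Riemann surface of genus $g\ge 2$, written as $X=Y/\pi_1$, where the universal cover $Y$ is realised as a simply connected domain in $\mathbb{C}$ (for instance the upper half plane) with coordinate $z$, and $$\pi_1=\Big\langle \alpha_1,\dots,\alpha_g,\beta_1,\dots,\beta_g \;\Big|\; \prod_{i=1}^g\alpha_i\beta_i\alpha_i^{-1}\beta_i^{-1}=1\Big\rangle$$ acts on $Y$ from the left by deck transformations. Put $R_k=\prod_{i=1}^k\alpha_i\beta_i\alpha_i^{-1}\beta_i^{-1}$. The generators are positively oriented standard generators: there is a fundamental domain for $\pi_1$ in $Y$ which is a $4g$-gon with $C^1$ sides whose vertices, in positive (counterclockwise) order, are $z_0,\ \alpha_1z_0,\ \alpha_1\beta_1z_0,\ \alpha_1\beta_1\alpha_1^{-1}z_0,\ R_1z_0,\ R_1\alpha_2z_0,\dots,R_gz_0=z_0$. Its sides are paired by $\pi_1$: for paths $a_j$ from $z_0$ to $\alpha_jz_0$ and $b_j$ from $z_0$ to $\beta_jz_0$, the four sides from $R_{j-1}z_0$ to $R_jz_0$ are $R_{j-1}a_j$, $R_{j-1}\alpha_jb_j$, and $R_j\beta_ja_j$,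 $R_jb_j$ run backwards. Let $G$ be a connected reductive complex algebraic group with Lie algebra $\mathfrak g$, let $K\subset G$ be a maximal compact subgroup, and let $\langle\,,\rangle$ be an $\mathrm{Ad}(K)$-invariant Hermitian inner product on $\mathfrak g$, linear in the first entry. Let $\rho:\pi_1\to G$ be a representation that is unitary ($\rho(\pi_1)\subset K$) and good ($\rho(\pi_1)$ lies in no proper parabolic subgroup of $G$, and the centralizer of $\rho(\pi_1)$ in $G$ is the center of $G$). Put $\mathrm{Ad}_\rho=\mathrm{Ad}\circ\rho$. The space $H^0(X,\mathrm{Ad}(E_\rho)\otimes\Omega^1_X)$ consists of the forms $\omega=h(z)\,dz$ with $h:Y\to\mathfrak g$ holomorphic and $h(\gamma z)\,\gamma'(z)=\mathrm{Ad}_\rho(\gamma)h(z)$ for all $\gamma\in\pi_1$, $z\in Y$. For $\omega_k=h_k(z)\,dz$, with $k=1,2$, put $$(\omega_1,\omega_2)=i\int_D\langle h_1(z),h_2(z)\rangle\,dz\wedge d\bar z ,$$ where $D\subset Y$ is a measurable fundamental domain for $\pi_1$. For $y\in Y$, the period map $$P_{\mathrm{Ad}_\rho}:H^0(X,\mathrm{Ad}(E_\rho)\otimes\Omega^1_X)\to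 H^1(\pi_1,\mathfrak g_{\mathrm{Ad}_\rho})$$ sends $\omega$ to the class of the cocycle $\gamma\mapsto\int_y^{\gamma y}\omega$. Extend cocycles $\phi:\pi_1\to\mathfrak g$ (where $\phi(\gamma\delta)=\phi(\gamma)+\mathrm{Ad}_\rho(\gamma)\phi(\delta)$) $\mathbb Z$-linearly to $\mathbb Z[\pi_1]$. Let $\sharp(\sum n_i\gamma_i)=\sum n_i\gamma_i^{-1}$, and let $\frac{\partial R}{\partial\alpha_j}=R_{j-1}-R_j\beta_j$ and $\frac{\partial R}{\partial\beta_j}=R_{j-1}\alpha_j-R_j$ be the Fox derivatives of $R=R_g$. The pairing on $H^1(\pi_1,\mathfrak g_{\mathrm{Ad}_\rho})$, well defined on classes, is $$\langle\!\langle\phi_1,\phi_2\rangle\!\rangle=-i\sum_{j=1}^g\Big(\Big\langle\phi_1\big(\sharp\tfrac{\partial R}{\partial\alpha_j}\big),\phi_2(\alpha_j)\Big\rangle+\Big\langle\phi_1\big(\sharp\tfrac{\partial R}{\partial\beta_j}\big),\phi_2(\beta_j)\Big\rangle\Big).$$ **Theorem.** For all $\omega_1,\omega_2\in H^0(X,\mathrm{Ad}(E_\rho)\otimes\Omega^1_X)$,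 every base point $y\in Y$ and every measurable fundamental domain $D$, the integral defining $(\omega_1,\omega_2)$ converges absolutely, and $$(\omega_1,\omega_2)=\langle\!\langle P_{\mathrm{Ad}_\rho}(\omega_1),P_{\mathrm{Ad}_\rho}(\omega_2)\rangle\!\rangle .$$ In other words, at a good and unitary representation the period map is unitary: it carries the $L^2$ Hermitian product to the pairing $\langle\!\langle\,,\rangle\!\rangle$. -/

import Mathlib

open MeasureTheory
open scoped Matrix MatrixGroups Manifold ContDiff Topology

/-! ### Linear algebraic groups over `ℂ` -/

section AlgebraicGroups

variable {n : ℕ}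

/-- Value of a polynomial in the matrix entries at a matrix. -/
noncomputable def evalMatrix (A : Matrix (Fin n) (Fin n) ℂ)
    (p : MvPolynomial (Fin n × Fin n) ℂ) : ℂ :=
  MvPolynomial.eval (fun ij => A ij.1 ij.2) p

/-- Zariski closed subsets of `GL_n(ℂ)`: zero loci of sets of polynomials in the entries. -/
def IsZariskiClosed (Z : Set (GL (Fin n) ℂ)) : Prop :=
  ∃ S : Set (MvPolynomial (Fin n × Fin n) ℂ),
    ∀ x : GL (Fin n) ℂ, x ∈ Z ↔ ∀ p ∈ S, evalMatrix (x : Matrix (Fin n) (Fin n) ℂ) p = 0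

/-- Connectedness in the Zariski topology. -/
def IsZariskiConnected (Z : Set (GL (Fin n) ℂ)) : Prop :=
  Z.Nonempty ∧ ∀ Z₁ Z₂ : Set (GL (Fin n) ℂ), IsZariskiClosed Z₁ → IsZariskiClosed Z₂ →
    Z ⊆ Z₁ ∪ Z₂ → (Z ∩ Z₁).Nonempty → (Z ∩ Z₂).Nonempty → (Z ∩ (Z₁ ∩ Z₂)).Nonempty

/-- A connected reductive complex algebraic group, realised as a Zariski closed subgroup of
`GL_n(ℂ)`: the only connected closed normal unipotent subgroup is trivial. -/
structure IsConnectedReductive (G : Subgroup (GL (Fin n) ℂ)) : Prop where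
  closed : IsZariskiClosed (G : Set (GL (Fin n) ℂ))
  connected : IsZariskiConnected (G : Set (GL (Fin n) ℂ))
  unipotent_radical : ∀ N : Subgroup (GL (Fin n) ℂ), N ≤ G →
    IsZariskiClosed (N : Set (GL (Fin n) ℂ)) → IsZariskiConnected (N : Set (GL (Fin n) ℂ)) →
    (∀ x ∈ G, ∀ u ∈ N, x * u * x⁻¹ ∈ N) →
    (∀ u ∈ N, IsNilpotent ((u : Matrix (Fin n) (Fin n) ℂ) - 1)) → N = ⊥

/-- `K` is a maximal compact subgroup of `G`. -/
structure IsMaximalCompact (G K : Subgroup (GL (Fin n) ℂ)) : Prop where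
  le : K ≤ G
  isCompact : IsCompact (K : Set (GL (Fin n) ℂ))
  maximal : ∀ L : Subgroup (GL (Fin n) ℂ), L ≤ G → IsCompact (L : Set (GL (Fin n) ℂ)) →
    K ≤ L → L = K

/-- Closed, connected and solvable subgroups of `G`. -/
structure IsClosedConnectedSolvable (G B : Subgroup (GL (Fin n) ℂ)) : Prop where
  le : B ≤ G
  closed : IsZariskiClosed (B : Set (GL (Fin n) ℂ))
  connected : IsZariskiConnected (B : Set (GL (Fin n) ℂ))
  solvable : Group.IsSolvable B

/-- Borel subgroups of `G`: maximal closed connected solvable subgroups. -/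
def IsBorel (G B : Subgroup (GL (Fin n) ℂ)) : Prop :=
  IsClosedConnectedSolvable G B ∧
    ∀ B' : Subgroup (GL (Fin n) ℂ), IsClosedConnectedSolvable G B' → B ≤ B' → B' = B

/-- Parabolic subgroups of `G`: closed subgroups that contain a Borel subgroup. -/
structure IsParabolic (G P : Subgroup (GL (Fin n) ℂ)) : Prop where
  le : P ≤ G
  closed : IsZariskiClosed (P : Set (GL (Fin n) ℂ))
  borel_le : ∃ B : Subgroup (GL (Fin n) ℂ), IsBorel G B ∧ B ≤ P

/-- A good representation: irreducible (the image lies in no proper parabolic subgroup), and its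
centralizer in `G` is the center of `G`. -/
structure IsGoodRep {π : Type*} [Group π] (G : Subgroup (GL (Fin n) ℂ)) (ρ : π →* G) : Prop where
  irreducible : ∀ P : Subgroup (GL (Fin n) ℂ), IsParabolic G P →
    (∀ γ : π, (ρ γ : GL (Fin n) ℂ) ∈ P) → P = G
  centralizer : Subgroup.centralizer (Set.range ρ) = Subgroup.center G

/-- The differential at the identity matrix of the polynomial function `p`, in the direction `A`. -/
noncomputable def diffAtOne (p : MvPolynomial (Fin n × Fin n) ℂ)
    (A : Matrix (Fin n) (Fin n) ℂ) : ℂ :=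
  ∑ ij : Fin n × Fin n, evalMatrix 1 (MvPolynomial.pderiv ij p) * A ij.1 ij.2

/-- The Lie algebra of `G`: the tangent space at the identity, cut out by the differentials of all
polynomials that vanish on `G`. -/
noncomputable def lieAlg (G : Subgroup (GL (Fin n) ℂ)) :
    Submodule ℂ (Matrix (Fin n) (Fin n) ℂ) where
  carrier := {A | ∀ p : MvPolynomial (Fin n × Fin n) ℂ,
    (∀ x ∈ G, evalMatrix (x : Matrix (Fin n) (Fin n) ℂ) p = 0) → diffAtOne p A = 0}
  zero_mem' := by
    intro p _
    simp [diffAtOne]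
  add_mem' := by
    intro A B hA hB p hp
    have h : diffAtOne p (A + B) = diffAtOne p A + diffAtOne p B := by
      simp [diffAtOne, mul_add, Finset.sum_add_distrib]
    rw [h, hA p hp, hB p hp, add_zero]
  smul_mem' := by
    intro c A hA p hp
    have h : diffAtOne p (c • A) = c * diffAtOne p A := by
      simp only [diffAtOne, Finset.mul_sum, Matrix.smul_apply, smul_eq_mul]
      exact Finset.sum_congr rfl fun _ _ => by ring
    rw [h, hA p hp, mul_zero]

/-- The polynomial `p(g X h)` in the entries of `X`. -/
noncomputable def sandwich (g h : Matrix (Fin n) (Fin n) ℂ) :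
    MvPolynomial (Fin n × Fin n) ℂ →ₐ[ℂ] MvPolynomial (Fin n × Fin n) ℂ :=
  MvPolynomial.aeval fun ij => ∑ k, ∑ l,
    MvPolynomial.C (g ij.1 k * h l ij.2) * MvPolynomial.X (k, l)

theorem evalMatrix_sandwich (g h A : Matrix (Fin n) (Fin n) ℂ)
    (p : MvPolynomial (Fin n × Fin n) ℂ) :
    evalMatrix A (sandwich g h p) = evalMatrix (g * A * h) p := by
  induction p using MvPolynomial.induction_on with
  | C a => simp [evalMatrix, sandwich]
  | add p q hp hq => simp only [evalMatrix, map_add] at *; rw [hp, hq]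
  | mul_X p ij hp =>
    simp only [evalMatrix, map_mul] at *
    rw [hp]
    congr 1
    simp only [sandwich, MvPolynomial.aeval_X, map_sum, map_mul, MvPolynomial.eval_C,
      MvPolynomial.eval_X, Matrix.mul_apply, Finset.sum_mul]
    rw [Finset.sum_comm]
    exact Finset.sum_congr rfl fun _ _ => Finset.sum_congr rfl fun _ _ => by ring

theorem diffAtOne_sandwich (g h A : Matrix (Fin n) (Fin n) ℂ) (hgh : g * h = 1)
    (p : MvPolynomial (Fin n × Fin n) ℂ) :
    diffAtOne (sandwich g h p) A = diffAtOne p (g * A * h) := by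
  induction p using MvPolynomial.induction_on with
  | C a => simp [diffAtOne, evalMatrix, sandwich]
  | add p q hp hq =>
    have e : ∀ (p q : MvPolynomial (Fin n × Fin n) ℂ) (A : Matrix (Fin n) (Fin n) ℂ),
        diffAtOne (p + q) A = diffAtOne p A + diffAtOne q A := by
      intro p q A
      simp [diffAtOne, evalMatrix, add_mul, Finset.sum_add_distrib]
    rw [map_add, e, e, hp, hq]
  | mul_X p ij hp =>
    have e : ∀ (p q : MvPolynomial (Fin n × Fin n) ℂ) (A : Matrix (Fin n) (Fin n) ℂ),
        diffAtOne (p * q) A = diffAtOne p A * evalMatrix 1 q + evalMatrix 1 p * diffAtOne q A := by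
      intro p q A
      simp only [diffAtOne, evalMatrix, Finset.sum_mul, Finset.mul_sum,
        ← Finset.sum_add_distrib, MvPolynomial.pderiv_mul, map_add, map_mul]
      exact Finset.sum_congr rfl fun _ _ => by ring
    have eX : ∀ (kl : Fin n × Fin n) (A : Matrix (Fin n) (Fin n) ℂ),
        diffAtOne (MvPolynomial.X kl) A = A kl.1 kl.2 := by
      intro kl A
      classical
      rw [diffAtOne, Finset.sum_eq_single kl]
      · simp [evalMatrix]
      · intro b _ hb
        rw [MvPolynomial.pderiv_X_of_ne hb.symm]
        simp [evalMatrix]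
      · simp
    have eS : diffAtOne (sandwich g h (MvPolynomial.X ij)) A = (g * A * h) ij.1 ij.2 := by
      have e1 : ∀ (s : Finset (Fin n × Fin n))
          (F : Fin n × Fin n → MvPolynomial (Fin n × Fin n) ℂ),
          diffAtOne (∑ x ∈ s, F x) A = ∑ x ∈ s, diffAtOne (F x) A := by
        intro s F
        simp only [diffAtOne, evalMatrix, map_sum, Finset.sum_mul]
        rw [Finset.sum_comm]
      have e2 : ∀ c : ℂ, ∀ kl, diffAtOne (MvPolynomial.C c * MvPolynomial.X kl) A
          = c * A kl.1 kl.2 := by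
        intro c kl
        rw [e, eX]
        simp [diffAtOne, evalMatrix]
      simp only [sandwich, MvPolynomial.aeval_X]
      rw [← Finset.univ.sum_product' Finset.univ
        (f := fun k l => MvPolynomial.C (g ij.1 k * h l ij.2) * MvPolynomial.X (k, l)), e1]
      simp only [e2]
      rw [Finset.sum_product]
      simp only [Matrix.mul_apply, Finset.sum_mul]
      rw [Finset.sum_comm]
      exact Finset.sum_congr rfl fun _ _ => Finset.sum_congr rfl fun _ _ => by ring
    rw [map_mul, e, e, hp, eS, eX, evalMatrix_sandwich, evalMatrix_sandwich]
    simp [hgh]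

theorem conj_mem_lieAlg {G : Subgroup (GL (Fin n) ℂ)} {x : GL (Fin n) ℂ} (hx : x ∈ G)
    {A : Matrix (Fin n) (Fin n) ℂ} (hA : A ∈ lieAlg G) :
    (x : Matrix (Fin n) (Fin n) ℂ) * A * ((x⁻¹ : GL (Fin n) ℂ) : Matrix (Fin n) (Fin n) ℂ)
      ∈ lieAlg G := by
  intro p hp
  rw [← diffAtOne_sandwich _ _ _ (by rw [← Units.val_mul, mul_inv_cancel, Units.val_one])]
  refine hA _ fun y hy => ?_
  rw [evalMatrix_sandwich, ← Units.val_mul, ← Units.val_mul]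
  exact hp _ (G.mul_mem (G.mul_mem hx hy) (G.inv_mem hx))

/-- The adjoint representation of `G` on its Lie algebra, `Ad(x) A = x A x⁻¹`. -/
noncomputable def adjointRep (G : Subgroup (GL (Fin n) ℂ)) : Representation ℂ G (lieAlg G) where
  toFun x :=
    { toFun := fun A => ⟨_, conj_mem_lieAlg x.2 A.2⟩
      map_add' := fun A B => Subtype.ext (by simp [mul_add, add_mul])
      map_smul' := fun c A => Subtype.ext (by simp) }
  map_one' := by
    ext A : 2
    simp
  map_mul' x y := by
    ext A : 2
    simp [mul_assoc]

/-- A Hermitian inner product on the Lie algebra of `G`, linear in the first entry, which is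
invariant under the adjoint action of `K`. -/
structure InvariantHermitian (G K : Subgroup (GL (Fin n) ℂ)) where
  form : lieAlg G →ₗ[ℂ] lieAlg G →ₗ⋆[ℂ] ℂ
  conj_symm : ∀ A B, form A B = starRingEnd ℂ (form B A)
  pos_def : ∀ A, A ≠ 0 → 0 < (form A A).re
  invariant : ∀ x : G, (x : GL (Fin n) ℂ) ∈ K → ∀ A B,
    form (adjointRep G x A) (adjointRep G x B) = form A B

/-- The representation `Ad_ρ` on the Lie algebra of `G`. -/
noncomputable def adRep {π : Type*} [Group π] {G : Subgroup (GL (Fin n) ℂ)} (ρ : π →* G) :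
    Representation ℂ π (lieAlg G) :=
  (adjointRep G).comp ρ

end AlgebraicGroups

/-! ### Primitives of holomorphic functions on simply connected domains -/

section Primitives

/-- A copy of `V` with the discrete topology. -/
@[ext] structure DiscreteCopy (V : Type*) where
  val : V

instance (V : Type*) : TopologicalSpace (DiscreteCopy V) := ⊥

instance (V : Type*) : DiscreteTopology (DiscreteCopy V) := ⟨rfl⟩

variable {V : Type*} [NormedAddCommGroup V] [NormedSpace ℂ V]

/-- A holomorphic function on a simply connected domain has a primitive. -/
theorem exists_primitive [CompleteSpace V] {Y : Set ℂ} (hY : IsOpen Y)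
    (hsc : IsSimplyConnected Y) {h : ℂ → V} (hh : DifferentiableOn ℂ h Y) :
    ∃ f : ℂ → V, ∀ z ∈ Y, HasDerivAt f (h z) z := by
  classical
  have hr : ∀ i : Y, ∃ r > 0, Metric.ball (i : ℂ) r ⊆ Y :=
    fun i => Metric.isOpen_iff.1 hY i i.2
  choose r hr0 hrY using hr
  have hg : ∀ i : Y, ∃ g : ℂ → V, ∀ z ∈ Metric.ball (i : ℂ) (r i), HasDerivAt g (h z) z :=
    fun i => (hh.mono (hrY i)).isExactOn_ball
  choose g hg using hg
  have hconst : ∀ i j : Y, ∃ c : V, ∀ z ∈ Metric.ball (i : ℂ) (r i) ∩ Metric.ball (j : ℂ) (r j),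
      g i z - g j z = c := by
    intro i j
    have ho : IsOpen (Metric.ball (i : ℂ) (r i) ∩ Metric.ball (j : ℂ) (r j)) :=
      Metric.isOpen_ball.inter Metric.isOpen_ball
    have hd : ∀ z ∈ Metric.ball (i : ℂ) (r i) ∩ Metric.ball (j : ℂ) (r j),
        HasDerivAt (fun z => g i z - g j z) 0 z := by
      intro z hz
      simpa using (hg i z hz.1).fun_sub (hg j z hz.2)
    have hp : IsPreconnected (Metric.ball (i : ℂ) (r i) ∩ Metric.ball (j : ℂ) (r j)) :=
      ((convex_ball _ _).inter (convex_ball _ _)).isPreconnected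
    exact ho.exists_is_const_of_deriv_eq_zero hp
      (fun z hz => (hd z hz).differentiableAt.differentiableWithinAt) (fun z hz => (hd z hz).deriv)
  let Z : FiberBundleCore Y Y (DiscreteCopy V) :=
    { baseSet := fun i => Subtype.val ⁻¹' Metric.ball (i : ℂ) (r i)
      isOpen_baseSet := fun i => Metric.isOpen_ball.preimage continuous_subtype_val
      indexAt := id
      mem_baseSet_at := fun x => Metric.mem_ball_self (hr0 x)
      coordChange := fun i j x v => ⟨v.val + (g i x - g j x)⟩
      coordChange_self := fun i x _ v => by simp
      continuousOn_coordChange := fun i j => by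
        obtain ⟨c, hc⟩ := hconst i j
        have h1 : Continuous fun p : Y × DiscreteCopy V => (⟨p.2.val + c⟩ : DiscreteCopy V) :=
          (continuous_of_discreteTopology
            (f := fun v : DiscreteCopy V => (⟨v.val + c⟩ : DiscreteCopy V))).comp continuous_snd
        refine h1.continuousOn.congr fun p hp => ?_
        rw [hc _ hp.1]
      coordChange_comp := fun i j k x _ v => by
        ext
        change (v.val + (g i x - g j x)) + (g j x - g k x) = v.val + (g i x - g k x)
        abel }
  have hcov : IsCoveringMap (Bundle.TotalSpace.proj : Bundle.TotalSpace (DiscreteCopy V) Z.Fiber → Y) :=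
    FiberBundle.isCoveringMap
  have := hsc.simplyConnectedSpace
  have := hY.locallyPathConnectedSpace
  obtain ⟨y₀, hy₀⟩ := hsc.nonempty
  obtain ⟨s, ⟨-, hs⟩, -⟩ := hcov.existsUnique_continuousMap_lifts (ContinuousMap.id Y) ⟨y₀, hy₀⟩
    ⟨⟨y₀, hy₀⟩, (⟨0⟩ : DiscreteCopy V)⟩ rfl
  have hs' : ∀ x, (s x).proj = x := fun x => congrFun hs x
  let F : Y → V := fun x => (show DiscreteCopy V from (s x).2).val + g (s x).proj x
  refine ⟨fun z => if hz : z ∈ Y then F ⟨z, hz⟩ else 0, fun z hz => ?_⟩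
  let i : Y := ⟨z, hz⟩
  have hcont : ContinuousAt (fun x => (Z.localTriv i (s x)).2) i := by
    have h1 : s i ∈ (Z.localTriv i).source := by
      rw [Z.mem_localTriv_source, hs']
      exact Metric.mem_ball_self (hr0 i)
    exact (continuous_snd.continuousAt.comp ((Z.localTriv i).continuousAt h1)).comp
      s.continuous.continuousAt
  have hev : ∀ᶠ x in 𝓝 i, (Z.localTriv i (s x)).2 = (Z.localTriv i (s i)).2 :=
    hcont.eventually (p := fun v => v = (Z.localTriv i (s i)).2)
      ((isOpen_discrete {(Z.localTriv i (s i)).2}).mem_nhds rfl)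
  have hF : ∀ x, (Z.localTriv i (s x)).2.val = F x - g i x := by
    intro x
    rw [Z.localTriv_apply]
    change (show DiscreteCopy V from (s x).2).val + (g (s x).proj (s x).proj - g i (s x).proj) = _
    rw [hs' x]
    simp only [F, hs' x]
    abel
  have hev2 : ∀ᶠ x in 𝓝 i, F x = g i x + (F i - g i i) := by
    filter_upwards [hev] with x hx
    have h2 : (F x - g i x : V) = F i - g i i := by rw [← hF, ← hF, hx]
    rw [← h2]; abel
  have hev3 : ∀ᶠ w in 𝓝 z, (if hw : w ∈ Y then F ⟨w, hw⟩ else 0) = g i w + (F i - g i i) := by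
    rw [nhds_subtype_eq_comap, Filter.eventually_comap] at hev2
    filter_upwards [hev2, hY.mem_nhds hz] with w hw hwY
    rw [dif_pos hwY]
    exact hw ⟨w, hwY⟩ rfl
  exact ((hg i z (Metric.mem_ball_self (hr0 i))).add_const _).congr_of_eventuallyEq hev3

end Primitives

/-! ### Surface groups -/

section SurfaceGroups

/-- The relator `∏ᵢ aᵢ bᵢ aᵢ⁻¹ bᵢ⁻¹` in the free group on `a₁, …, a_g` (`Sum.inl`) and
`b₁, …, b_g` (`Sum.inr`). -/
def surfaceRelator (g : ℕ) : FreeGroup (Fin g ⊕ Fin g) :=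
  (List.ofFn fun i : Fin g => FreeGroup.of (Sum.inl i) * FreeGroup.of (Sum.inr i) *
    (FreeGroup.of (Sum.inl i))⁻¹ * (FreeGroup.of (Sum.inr i))⁻¹).prod

/-- The fundamental group of a closed oriented surface of genus `g`, by its usual presentation. -/
abbrev SurfaceGroup (g : ℕ) : Type := PresentedGroup {surfaceRelator g}

namespace SurfaceGroup

variable {g : ℕ}

/-- The generator `α_i`. -/
def α (i : Fin g) : SurfaceGroup g := PresentedGroup.of (Sum.inl i)

/-- The generator `β_i`. -/
def β (i : Fin g) : SurfaceGroup g := PresentedGroup.of (Sum.inr i)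

/-- The product `R_k` of the first `k` commutators `α_i β_i α_i⁻¹ β_i⁻¹`. -/
def R (g k : ℕ) : SurfaceGroup g :=
  ((List.ofFn fun i : Fin g => α i * β i * (α i)⁻¹ * (β i)⁻¹).take k).prod

theorem R_zero : R g 0 = 1 := rfl

theorem R_succ (j : Fin g) :
    R g (j + 1) = R g j * (α j * β j * (α j)⁻¹ * (β j)⁻¹) := by
  rw [R, List.prod_take_succ _ _ (by simp)]
  simp [R]

theorem R_last : R g g = 1 := by
  have h : R g g = PresentedGroup.mk {surfaceRelator g} (surfaceRelator g) := by
    rw [R, List.take_of_length_le (by simp)]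
    unfold surfaceRelator
    rw [map_list_prod, List.map_ofFn]
    congr 2
  rw [h]
  exact PresentedGroup.one_of_mem (Set.mem_singleton _)

end SurfaceGroup

end SurfaceGroups

/-! ### Riemann surfaces, holomorphic forms and periods -/

section Surfaces

/-- A Riemann surface `X` presented as the quotient of a simply connected plane domain `Y`
(its universal cover, with global coordinate `z`) by the surface group of genus `g`, which acts
on `Y` as the group of deck transformations. -/
structure UniformizedSurface (g : ℕ) (X : Type*) [TopologicalSpace X] [ChartedSpace ℂ X] where
  Y : TopologicalSpace.Opens ℂ
  simplyConnected : IsSimplyConnected (Y : Set ℂ)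
  action : MulAction (SurfaceGroup g) Y
  proj : Y → X
  proj_holomorphic : MDifferentiable 𝓘(ℂ) 𝓘(ℂ) proj
  covering : IsQuotientCoveringMap proj (SurfaceGroup g)
  smul_holomorphic : ∀ γ : SurfaceGroup g,
    ∃ f : ℂ → ℂ, DifferentiableOn ℂ f Y ∧ ∀ z : Y, f z = ((γ • z : Y) : ℂ)

variable {g : ℕ} {X : Type*} [TopologicalSpace X] [ChartedSpace ℂ X]

namespace UniformizedSurface

instance (S : UniformizedSurface g X) : MulAction (SurfaceGroup g) S.Y := S.action

open Classical in
/-- The deck transformation `γ` as a function of the coordinate `z ∈ Y`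
(with junk values off `Y`). -/
noncomputable def deck (S : UniformizedSurface g X) (γ : SurfaceGroup g) (z : ℂ) : ℂ :=
  if h : z ∈ S.Y then ((γ • (⟨z, h⟩ : S.Y) : S.Y) : ℂ) else z

theorem deck_coe (S : UniformizedSurface g X) (γ : SurfaceGroup g) (z : S.Y) :
    S.deck γ z = ((γ • z : S.Y) : ℂ) := by simp [deck]

theorem hasDerivAt_deck (S : UniformizedSurface g X) (γ : SurfaceGroup g) (z : S.Y) :
    HasDerivAt (S.deck γ) (deriv (S.deck γ) z) z := by
  obtain ⟨f, hf, hfY⟩ := S.smul_holomorphic γ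
  have h : DifferentiableOn ℂ (S.deck γ) S.Y :=
    hf.congr fun w hw => by rw [S.deck_coe γ ⟨w, hw⟩, hfY ⟨w, hw⟩]
  exact (h.differentiableAt (S.Y.isOpen.mem_nhds z.2)).hasDerivAt

theorem continuous_smul_coe (S : UniformizedSurface g X) (γ : SurfaceGroup g) :
    Continuous fun z : S.Y => ((γ • z : S.Y) : ℂ) :=
  continuous_subtype_val.comp (S.covering.toContinuousConstSMul.continuous_const_smul γ)

/-- The translate by `γ` of a path in `Y`, as a path in `ℂ`. -/
noncomputable def translate (S : UniformizedSurface g X) (γ : SurfaceGroup g) {z w : S.Y} (c : Path z w) :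
    Path ((γ • z : S.Y) : ℂ) ((γ • w : S.Y) : ℂ) :=
  c.map (S.continuous_smul_coe γ)

/-- Lebesgue measure `dx dy` on `Y`. -/
noncomputable def area (S : UniformizedSurface g X) : Measure S.Y :=
  (volume : Measure ℂ).comap Subtype.val

/-- A `4g`-gon in `Y` which is a fundamental domain for the action of the surface group, with
positively oriented boundary whose consecutive vertices are
`z₀, α₁z₀, α₁β₁z₀, α₁β₁α₁⁻¹z₀, R₁z₀, R₁α₂z₀, …, R_g z₀ = z₀`, and whose sides are identified in
pairs by the group. The sides issuing from the vertex `R_{j-1} z₀` are the translates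
`R_{j-1} a_j`, `R_{j-1} α_j b_j`, and then `R_j β_j a_j` and `R_j b_j` run backwards. -/
structure FundamentalPolygon (S : UniformizedSurface g X) where
  z₀ : S.Y
  a : ∀ j : Fin g, Path z₀ (SurfaceGroup.α j • z₀)
  b : ∀ j : Fin g, Path z₀ (SurfaceGroup.β j • z₀)
  a_contDiff : ∀ j, ContDiffOn ℝ 1 (fun t : ℝ => ((a j).extend t : ℂ)) (Set.Icc 0 1)
  b_contDiff : ∀ j, ContDiffOn ℝ 1 (fun t : ℝ => ((b j).extend t : ℂ)) (Set.Icc 0 1)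
  D : Set S.Y
  isFundamentalDomain : IsFundamentalDomain (SurfaceGroup g) D S.area
  /-- The closed polygonal curve bounds `D` positively: off the curve, its winding number
  `(2πi)⁻¹ ∮ dz / (z - w)` is `1` around the points of `D` and `0` around all other points. -/
  bounds : ∀ w : ℂ,
    (∀ j : Fin g,
      w ∉ Set.range (S.translate (SurfaceGroup.R g j) (a j)) ∧
      w ∉ Set.range (S.translate (SurfaceGroup.R g j * SurfaceGroup.α j) (b j)) ∧
      w ∉ Set.range (S.translate (SurfaceGroup.R g (j + 1) * SurfaceGroup.β j) (a j)) ∧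
      w ∉ Set.range (S.translate (SurfaceGroup.R g (j + 1)) (b j))) →
    (2 * Real.pi * Complex.I)⁻¹ * ∑ j : Fin g,
      (curveIntegral (fun z => (z - w)⁻¹ • (1 : ℂ →L[ℂ] ℂ))
          (S.translate (SurfaceGroup.R g j) (a j)) +
        curveIntegral (fun z => (z - w)⁻¹ • (1 : ℂ →L[ℂ] ℂ))
          (S.translate (SurfaceGroup.R g j * SurfaceGroup.α j) (b j)) -
        curveIntegral (fun z => (z - w)⁻¹ • (1 : ℂ →L[ℂ] ℂ))
          (S.translate (SurfaceGroup.R g (j + 1) * SurfaceGroup.β j) (a j)) -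
        curveIntegral (fun z => (z - w)⁻¹ • (1 : ℂ →L[ℂ] ℂ))
          (S.translate (SurfaceGroup.R g (j + 1)) (b j))) =
      Set.indicator (Subtype.val '' D) 1 w

variable {V : Type} [NormedAddCommGroup V] [NormedSpace ℂ V] [FiniteDimensional ℂ V]

/-- Holomorphic sections over `X` of `V_σ ⊗ Ω¹`, where `V_σ` is the flat bundle `(Y × V) / π₁`
with `(z, v) ∼ (γ z, σ(γ) v)`. Such a section is given by its pullback `h(z) dz` to `Y`, where
`h : Y → V` is holomorphic and `h(γ z) γ'(z) = σ(γ) h(z)`. The function `h` is extended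
by `0` off `Y`. -/
noncomputable def holomorphicForms (S : UniformizedSurface g X) (σ : Representation ℂ (SurfaceGroup g) V) :
    Submodule ℂ (ℂ → V) where
  carrier := {h | DifferentiableOn ℂ h S.Y ∧ (∀ z ∉ S.Y, h z = 0) ∧
    ∀ (γ : SurfaceGroup g) (z : S.Y),
      deriv (S.deck γ) z • h ((γ • z : S.Y) : ℂ) = σ γ (h z)}
  zero_mem' := ⟨differentiableOn_const 0, fun _ _ => rfl, fun γ z => by simp⟩
  add_mem' := by
    rintro h k ⟨h1, h2, h3⟩ ⟨k1, k2, k3⟩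
    refine ⟨h1.add k1, fun z hz => ?_, fun γ z => ?_⟩
    · simp [h2 z hz, k2 z hz]
    · simp [smul_add, h3, k3]
  smul_mem' := by
    rintro c h ⟨h1, h2, h3⟩
    refine ⟨h1.const_smul c, fun z hz => ?_, fun γ z => ?_⟩
    · simp [h2 z hz]
    · simp [smul_comm _ c, h3]

/-- The product `(ω₁, ω₂) = i ∫_D ⟨h₁(z), h₂(z)⟩ dz ∧ dz̄`, with `dz ∧ dz̄ = -2i dx dy`. -/
noncomputable def hermitianProduct (S : UniformizedSurface g X) (B : V →ₗ[ℂ] V →ₗ⋆[ℂ] ℂ)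
    (D : Set S.Y) (h₁ h₂ : ℂ → V) : ℂ :=
  Complex.I * ∫ z in D, B (h₁ z) (h₂ z) * (-2 * Complex.I) ∂S.area

/-- A primitive on `Y` of the form `h(z) dz`. -/
noncomputable def primitive (S : UniformizedSurface g X)
    {σ : Representation ℂ (SurfaceGroup g) V} (h : S.holomorphicForms σ) : ℂ → V :=
  have : CompleteSpace V := FiniteDimensional.complete ℂ V
  (exists_primitive S.Y.isOpen S.simplyConnected h.2.1).choose

theorem hasDerivAt_primitive (S : UniformizedSurface g X)
    {σ : Representation ℂ (SurfaceGroup g) V} (h : S.holomorphicForms σ) (z : S.Y) :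
    HasDerivAt (S.primitive h) (h.1 z) z :=
  have : CompleteSpace V := FiniteDimensional.complete ℂ V
  (exists_primitive S.Y.isOpen S.simplyConnected h.2.1).choose_spec z z.2

/-- The integral `∫_z^w h(ζ) dζ` in `Y`. -/
noncomputable def integral (S : UniformizedSurface g X)
    {σ : Representation ℂ (SurfaceGroup g) V} (h : S.holomorphicForms σ) (z w : S.Y) : V :=
  S.primitive h w - S.primitive h z

/-- Uniqueness of primitives: the integral can be computed by any primitive. -/
theorem integral_eq (S : UniformizedSurface g X)
    {σ : Representation ℂ (SurfaceGroup g) V} (h : S.holomorphicForms σ) {f : ℂ → V}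
    (hf : ∀ z : S.Y, HasDerivAt f (h.1 z) z) (z w : S.Y) :
    S.integral h z w = f w - f z := by
  have hd : ∀ z ∈ (S.Y : Set ℂ), HasDerivAt (fun z => S.primitive h z - f z) 0 z := by
    intro z hz
    simpa using (S.hasDerivAt_primitive h ⟨z, hz⟩).fun_sub (hf ⟨z, hz⟩)
  obtain ⟨c, hc⟩ := S.Y.isOpen.exists_is_const_of_deriv_eq_zero
    S.simplyConnected.isPathConnected.isConnected.isPreconnected
    (fun z hz => (hd z hz).differentiableAt.differentiableWithinAt) (fun z hz => (hd z hz).deriv)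
  have h1 := hc z z.2
  have h2 := hc w w.2
  rw [integral, sub_eq_iff_eq_add.1 h1, sub_eq_iff_eq_add.1 h2]
  abel

/-- The integral is the curve integral of `h(ζ) dζ` along every `C¹` path in `Y`. -/
theorem integral_eq_curveIntegral (S : UniformizedSurface g X)
    {σ : Representation ℂ (SurfaceGroup g) V} (h : S.holomorphicForms σ) {z w : S.Y}
    (c : Path z w)
    (hc : ContDiffOn ℝ 1 (fun t : ℝ => (c.extend t : ℂ)) (Set.Icc 0 1)) :
    S.integral h z w =
      curveIntegral (fun ζ => ContinuousLinearMap.toSpanSingleton ℂ (h.1 ζ))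
        (c.map continuous_subtype_val) := by
  have hcont : ContinuousOn (fun ζ => ContinuousLinearMap.toSpanSingleton ℂ (h.1 ζ)) S.Y :=
    (ContinuousLinearMap.toSpanSingletonCLE (𝕜 := ℂ) (E := V)).continuous.comp_continuousOn
      h.2.1.continuousOn
  have : CompleteSpace V := FiniteDimensional.complete ℂ V
  have hext : ∀ t, (c.map continuous_subtype_val).extend t = (c.extend t : ℂ) := fun _ => rfl
  have hc' : ContDiffOn ℝ 1 (c.map continuous_subtype_val).extend (Set.Icc 0 1) := hc
  have hint : CurveIntegrable (fun ζ => ContinuousLinearMap.toSpanSingleton ℂ (h.1 ζ))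
      (c.map continuous_subtype_val) :=
    hcont.curveIntegrable_of_contDiffOn hc' fun t => (c t).2
  rw [CurveIntegrable] at hint
  rw [curveIntegral_def, intervalIntegral.integral_eq_sub_of_hasDerivAt_of_le zero_le_one
    (f := fun t => S.primitive h ((c.map continuous_subtype_val).extend t)) _ _ hint]
  · simp [integral, hext]
  · have : ContinuousOn (S.primitive h) S.Y :=
      fun z hz => (S.hasDerivAt_primitive h ⟨z, hz⟩).continuousAt.continuousWithinAt
    exact this.comp hc'.continuousOn fun t _ => (c.extend t).2
  · intro t ht
    have h1 : DifferentiableAt ℝ (c.map continuous_subtype_val).extend t :=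
      (hc'.differentiableOn one_ne_zero).differentiableAt (Icc_mem_nhds ht.1 ht.2)
    have h2 := HasDerivAt.scomp t (S.hasDerivAt_primitive h (c.extend t)) h1.hasDerivAt
    rw [curveIntegralFun_def, derivWithin_of_mem_nhds (Icc_mem_nhds ht.1 ht.2)]
    exact h2

theorem integral_add_integral (S : UniformizedSurface g X)
    {σ : Representation ℂ (SurfaceGroup g) V} (h : S.holomorphicForms σ) (x y z : S.Y) :
    S.integral h x y + S.integral h y z = S.integral h x z := by
  simp [integral]

theorem integral_smul (S : UniformizedSurface g X)
    {σ : Representation ℂ (SurfaceGroup g) V} (h : S.holomorphicForms σ) (γ : SurfaceGroup g)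
    (z w : S.Y) : S.integral h (γ • z) (γ • w) = σ γ (S.integral h z w) := by
  have hd : ∀ z ∈ (S.Y : Set ℂ),
      HasDerivAt (fun z => S.primitive h (S.deck γ z) - σ γ (S.primitive h z)) 0 z := by
    intro z hz
    have h1 := S.hasDerivAt_deck γ ⟨z, hz⟩
    have h2 := S.hasDerivAt_primitive h (γ • ⟨z, hz⟩)
    rw [← S.deck_coe γ ⟨z, hz⟩] at h2
    have h3 := HasDerivAt.scomp z h2 h1
    have h4 := (LinearMap.toContinuousLinearMap (σ γ)).hasFDerivAt.comp_hasDerivAt z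
      (S.hasDerivAt_primitive h ⟨z, hz⟩)
    have h5 := h.2.2.2 γ ⟨z, hz⟩
    rw [← S.deck_coe γ ⟨z, hz⟩] at h5
    have h6 := h3.fun_sub h4
    rw [h5] at h6
    simpa [Function.comp_def] using h6
  obtain ⟨c, hc⟩ := S.Y.isOpen.exists_is_const_of_deriv_eq_zero
    S.simplyConnected.isPathConnected.isConnected.isPreconnected
    (fun z hz => (hd z hz).differentiableAt.differentiableWithinAt) (fun z hz => (hd z hz).deriv)
  have h1 := hc z z.2
  have h2 := hc w w.2
  simp only [S.deck_coe] at h1 h2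
  rw [integral, sub_eq_iff_eq_add.1 h1, sub_eq_iff_eq_add.1 h2, integral, map_sub]
  abel

/-- The period cocycle `γ ↦ ∫_y^{γ y} ω`. -/
noncomputable def periodCocycle (S : UniformizedSurface g X)
    (σ : Representation ℂ (SurfaceGroup g) V) (y : S.Y) :
    S.holomorphicForms σ →ₗ[ℂ] groupCohomology.cocycles₁ (Rep.of σ) where
  toFun h := ⟨fun γ => S.integral h y (γ • y), by
    rw [groupCohomology.mem_cocycles₁_iff]
    intro γ δ
    rw [mul_smul, ← S.integral_add_integral h y (γ • y), S.integral_smul, add_comm]⟩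
  map_add' h k := by
    ext γ
    change S.integral (h + k) y (γ • y) = S.integral h y (γ • y) + S.integral k y (γ • y)
    rw [S.integral_eq (h + k) (f := fun z => S.primitive h z + S.primitive k z)
      fun z => (S.hasDerivAt_primitive h z).fun_add (S.hasDerivAt_primitive k z)]
    simp only [integral]
    abel
  map_smul' c h := by
    ext γ
    change S.integral (c • h) y (γ • y) = c • S.integral h y (γ • y)
    rw [S.integral_eq (c • h) (f := fun z => c • S.primitive h z)
      fun z => (S.hasDerivAt_primitive h z).fun_const_smul c]
    simp only [integral, smul_sub]

/-- The period map, which sends `ω` to the class of its period cocycle. -/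
noncomputable def periodMap (S : UniformizedSurface g X)
    (σ : Representation ℂ (SurfaceGroup g) V) (y : S.Y) :
    S.holomorphicForms σ →ₗ[ℂ] groupCohomology.H1 (Rep.of σ) :=
  (groupCohomology.H1π (Rep.of σ)).hom ∘ₗ S.periodCocycle σ y

end UniformizedSurface

end Surfaces

/-! ### Fox calculus and the pairing on cohomology -/

section FoxCalculus

open SurfaceGroup

variable {g : ℕ} {V : Type} [AddCommGroup V]

/-- The Fox derivative `∂R/∂α_j = R_{j-1} - R_j β_j` in `ℤ[π₁]`. -/
noncomputable def foxα (j : Fin g) : MonoidAlgebra ℤ (SurfaceGroup g) :=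
  MonoidAlgebra.of ℤ _ (R g j) - MonoidAlgebra.of ℤ _ (R g (j + 1) * β j)

/-- The Fox derivative `∂R/∂β_j = R_{j-1} α_j - R_j` in `ℤ[π₁]`. -/
noncomputable def foxβ (j : Fin g) : MonoidAlgebra ℤ (SurfaceGroup g) :=
  MonoidAlgebra.of ℤ _ (R g j * α j) - MonoidAlgebra.of ℤ _ (R g (j + 1))

/-- The involution `♯ (∑ nᵢ γᵢ) = ∑ nᵢ γᵢ⁻¹` of `ℤ[π₁]`. -/
noncomputable def sharp (x : MonoidAlgebra ℤ (SurfaceGroup g)) :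
    MonoidAlgebra ℤ (SurfaceGroup g) :=
  MonoidAlgebra.ofCoeff (x.coeff.mapDomain fun γ => γ⁻¹)

/-- The `ℤ`-linear extension of a function `π₁ → V` to the group ring. -/
noncomputable def extendZ (φ : SurfaceGroup g → V) (x : MonoidAlgebra ℤ (SurfaceGroup g)) : V :=
  x.coeff.sum fun γ m => m • φ γ

theorem extendZ_sharp (φ : SurfaceGroup g → V) (γ δ : SurfaceGroup g) :
    extendZ φ (sharp (MonoidAlgebra.of ℤ _ γ - MonoidAlgebra.of ℤ _ δ)) = φ γ⁻¹ - φ δ⁻¹ := by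
  have h1 : (sharp (MonoidAlgebra.of ℤ _ γ - MonoidAlgebra.of ℤ _ δ)).coeff =
      Finsupp.single γ⁻¹ (1 : ℤ) - Finsupp.single δ⁻¹ 1 := by
    simp [sharp, sub_eq_add_neg, Finsupp.mapDomain_add, ← Finsupp.single_neg,
      Finsupp.mapDomain_single]
  rw [extendZ, h1, Finsupp.sum_sub_index (fun _ _ _ => sub_smul _ _ _)]
  simp

variable [Module ℂ V]

/-- The pairing of cocycles
`-i ∑ⱼ (⟨φ₁(♯ ∂R/∂α_j), φ₂(α_j)⟩ + ⟨φ₁(♯ ∂R/∂β_j), φ₂(β_j)⟩)`. -/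
noncomputable def cocyclePairing (B : V →ₗ[ℂ] V →ₗ⋆[ℂ] ℂ) (φ₁ φ₂ : SurfaceGroup g → V) : ℂ :=
  -Complex.I * ∑ j : Fin g,
    (B (extendZ φ₁ (sharp (foxα j))) (φ₂ (α j)) + B (extendZ φ₁ (sharp (foxβ j))) (φ₂ (β j)))

/-- The pairing on `H¹(π₁, V_σ)` induced by `cocyclePairing`. It is well defined when the form `B`
is invariant under the action, see `cohomologyPairing_mk`. -/
noncomputable def cohomologyPairing {σ : Representation ℂ (SurfaceGroup g) V}
    (B : V →ₗ[ℂ] V →ₗ⋆[ℂ] ℂ) (c₁ c₂ : groupCohomology.H1 (Rep.of σ)) : ℂ :=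
  cocyclePairing B
    (Function.surjInv ((ModuleCat.epi_iff_surjective (groupCohomology.H1π (Rep.of σ))).1
      inferInstance) c₁ : groupCohomology.cocycles₁ (Rep.of σ))
    (Function.surjInv ((ModuleCat.epi_iff_surjective (groupCohomology.H1π (Rep.of σ))).1
      inferInstance) c₂ : groupCohomology.cocycles₁ (Rep.of σ))

section WellDefined

variable {σ : Representation ℂ (SurfaceGroup g) V} {B : V →ₗ[ℂ] V →ₗ⋆[ℂ] ℂ}

theorem cocyclePairing_sub_left (φ ψ χ : SurfaceGroup g → V) :
    cocyclePairing B (φ - ψ) χ = cocyclePairing B φ χ - cocyclePairing B ψ χ := by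
  simp only [cocyclePairing, ← mul_sub, ← Finset.sum_sub_distrib, foxα, foxβ, extendZ_sharp,
    Pi.sub_apply, map_sub, LinearMap.sub_apply]
  congr 1
  exact Finset.sum_congr rfl fun _ _ => by ring

theorem cocyclePairing_sub_right (χ φ ψ : SurfaceGroup g → V) :
    cocyclePairing B χ (φ - ψ) = cocyclePairing B χ φ - cocyclePairing B χ ψ := by
  simp only [cocyclePairing, ← mul_sub, ← Finset.sum_sub_distrib, Pi.sub_apply, map_sub]
  congr 1
  exact Finset.sum_congr rfl fun _ _ => by ring

theorem cocyclePairing_coboundary_left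
    (hB : ∀ γ v w, B (σ γ v) (σ γ w) = B v w) (v : V)
    (φ : SurfaceGroup g → V) (hφ : ∀ γ δ, φ (γ * δ) = σ γ (φ δ) + φ γ) :
    cocyclePairing B (fun γ => σ γ v - v) φ = 0 := by
  have hadj : ∀ γ w, B (σ γ⁻¹ v) w = B v (σ γ w) := by
    intro γ w
    rw [← hB γ, ← Module.End.mul_apply, ← map_mul, mul_inv_cancel, map_one, Module.End.one_apply]
  have h1 : φ 1 = 0 := by simpa using hφ 1 1
  have hR : ∀ j : Fin g, σ (R g j) (φ (α j)) - σ (R g (j + 1) * β j) (φ (α j)) +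
      (σ (R g j * α j) (φ (β j)) - σ (R g (j + 1)) (φ (β j))) = φ (R g (j + 1)) - φ (R g j) := by
    intro j
    have e : R g (j + 1) * β j * α j = R g j * α j * β j := by rw [R_succ]; group
    have e1 := hφ (R g (j + 1) * β j) (α j)
    rw [e, hφ, hφ, hφ (R g (j + 1))] at e1
    rw [← sub_eq_zero] at e1 ⊢
    rw [← e1]
    abel
  have key : ∀ j : Fin g,
      B (extendZ (fun γ => σ γ v - v) (sharp (foxα j))) (φ (α j)) +
        B (extendZ (fun γ => σ γ v - v) (sharp (foxβ j))) (φ (β j)) =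
      B v (φ (R g (j + 1))) - B v (φ (R g j)) := by
    intro j
    rw [foxα, foxβ, extendZ_sharp, extendZ_sharp, sub_sub_sub_cancel_right,
      sub_sub_sub_cancel_right, map_sub, map_sub, LinearMap.sub_apply, LinearMap.sub_apply,
      hadj, hadj, hadj, hadj, ← map_sub, ← map_sub, ← map_sub, ← map_add, hR]
  rw [cocyclePairing, Finset.sum_congr rfl fun j _ => key j,
    Fin.sum_univ_eq_sum_range (fun k => B v (φ (R g (k + 1))) - B v (φ (R g k))),
    Finset.sum_range_sub (fun k => B v (φ (R g k))), R_last, R_zero, h1]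
  simp

theorem cocyclePairing_coboundary_right
    (hB : ∀ γ v w, B (σ γ v) (σ γ w) = B v w) (v : V)
    (φ : SurfaceGroup g → V) (hφ : ∀ γ δ, φ (γ * δ) = σ γ (φ δ) + φ γ) :
    cocyclePairing B φ (fun γ => σ γ v - v) = 0 := by
  have hadj : ∀ γ w, B w (σ γ v) = B (σ γ⁻¹ w) v := by
    intro γ w
    rw [← hB γ (σ γ⁻¹ w), ← Module.End.mul_apply, ← map_mul, mul_inv_cancel, map_one,
      Module.End.one_apply]
  have hs : ∀ γ δ, σ γ⁻¹ (φ δ⁻¹) = φ (δ * γ)⁻¹ - φ γ⁻¹ := by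
    intro γ δ
    rw [mul_inv_rev, hφ, add_sub_cancel_right]
  have h1 : φ 1 = 0 := by simpa using hφ 1 1
  have key : ∀ j : Fin g,
      B (extendZ φ (sharp (foxα j))) (σ (α j) v - v) +
        B (extendZ φ (sharp (foxβ j))) (σ (β j) v - v) =
      B (φ (R g (j + 1))⁻¹) v - B (φ (R g j)⁻¹) v := by
    intro j
    have e : R g (j + 1) * β j * α j = R g j * α j * β j := by rw [R_succ]; group
    rw [foxα, foxβ, extendZ_sharp, extendZ_sharp]
    simp only [map_sub, LinearMap.sub_apply, hadj, hs, e]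
    ring
  rw [cocyclePairing, Finset.sum_congr rfl fun j _ => key j,
    Fin.sum_univ_eq_sum_range (fun k => B (φ (R g (k + 1))⁻¹) v - B (φ (R g k)⁻¹) v),
    Finset.sum_range_sub (fun k => B (φ (R g k)⁻¹) v), R_last, R_zero, inv_one, h1]
  simp

/-- For an invariant form, the pairing is well defined on cohomology classes. -/
theorem cohomologyPairing_mk (hB : ∀ γ v w, B (σ γ v) (σ γ w) = B v w)
    (φ₁ φ₂ : groupCohomology.cocycles₁ (Rep.of σ)) :
    cohomologyPairing B (groupCohomology.H1π (Rep.of σ) φ₁) (groupCohomology.H1π (Rep.of σ) φ₂) =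
      cocyclePairing B φ₁ φ₂ := by
  have hc : ∀ φ : groupCohomology.cocycles₁ (Rep.of σ),
      ∀ γ δ, φ (γ * δ) = σ γ (φ δ) + φ γ :=
    fun φ => (groupCohomology.mem_cocycles₁_iff (A := Rep.of σ) φ).1 φ.2
  have hb : ∀ φ ψ : groupCohomology.cocycles₁ (Rep.of σ),
      groupCohomology.H1π (Rep.of σ) φ = groupCohomology.H1π (Rep.of σ) ψ →
      ∃ v : V, (⇑φ - ⇑ψ : SurfaceGroup g → V) = fun γ => σ γ v - v := by
    intro φ ψ h
    obtain ⟨v, hv⟩ := (groupCohomology.H1π_eq_iff φ ψ).1 h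
    exact ⟨v, hv.symm⟩
  have hsurj := (ModuleCat.epi_iff_surjective (groupCohomology.H1π (Rep.of σ))).1 inferInstance
  obtain ⟨v₁, hv₁⟩ := hb _ φ₁ (Function.surjInv_eq hsurj (groupCohomology.H1π (Rep.of σ) φ₁))
  obtain ⟨v₂, hv₂⟩ := hb _ φ₂ (Function.surjInv_eq hsurj (groupCohomology.H1π (Rep.of σ) φ₂))
  rw [cohomologyPairing]
  have e1 := cocyclePairing_coboundary_left hB v₁ _
    (hc (Function.surjInv hsurj (groupCohomology.H1π (Rep.of σ) φ₂)))
  have e2 := cocyclePairing_coboundary_right hB v₂ _ (hc φ₁)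
  rw [← hv₁, cocyclePairing_sub_left, sub_eq_zero] at e1
  rw [← hv₂, cocyclePairing_sub_right, sub_eq_zero] at e2
  rw [e1, e2]

end WellDefined

end FoxCalculus

/- The entrywise sup norm on matrices; it only serves to speak of holomorphic functions with values
in a finite-dimensional space of matrices. -/
attribute [local instance] Matrix.normedAddCommGroup Matrix.normedSpace

/-!
Write `⟨ , ⟩` for an invariant Hermitian inner product on the fibre, `h dz` and `k dz` for two
holomorphic forms, and `f = ∫_{z₀} k dz` for a primitive on `Y`. Since
`∂/∂z̄ ⟨h, f⟩ = ⟨h, k⟩`, Stokes' formula on the fundamental polygon `D` gives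
`∮ ⟨h, f⟩ dz = 2i ∫_D ⟨h, k⟩ dx dy`. A deck transformation `γ` changes `⟨h, f⟩ dz` by
`-⟨h, φ_k(γ⁻¹)⟩ dz`, where `φ_k` is the period cocycle of `k dz` at the base point `z₀`. Hence the
two sides of the polygon in one pair contribute, together, `-⟨φ_h, φ_k⟩` evaluated on a generator
and on the image under `♯` of the corresponding Fox derivative of the relator
(`curveIntegral_translate_sesquilinear`, `FundamentalPolygon.integrableOn_and_integral_eq`).
Complex conjugation moves the Fox derivative into the first slot and yields the pairing on
cohomology.

The polygon is only known through the winding number of its boundary, so Stokes' formula is proved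
in the form `∮ F dz = 2i ∫ w(z) ∂F/∂z̄ dx dy`, where `w` is the winding number of the chain. For
compactly supported `F` this comes from the Cauchy–Pompeiu formula (`cauchyPompeiu`), integrated
along the chain, and Fubini's theorem (`integrable_and_curveIntegral_eq`). Continuity of the winding
number off the chain and its decay at infinity show that the polygon together with its boundary is
compact in `Y` (`isCompact_union_of_winding`), so that a cut-off function reduces the general case
to this one. Compactness also gives absolute convergence.

Lebesgue measure is not invariant under deck transformations. An arbitrary fundamental domain is
compared with the polygon by means of the invariant measure with density `⟨h, h⟩ + ⟨k, k⟩`,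
relative to which `⟨h, k⟩ dx dy` has an invariant density (`integrableOn_iff_and_setIntegral_eq`).
-/

/-! ### The Cauchy–Pompeiu formula -/

section CauchyPompeiu

open Set Metric

/-- The Wirtinger derivative `∂F/∂z̄ = (∂F/∂x + i ∂F/∂y) / 2`. -/
noncomputable def wirtingerBar (F : ℂ → ℂ) (w : ℂ) : ℂ :=
  (fderiv ℝ F w 1 + Complex.I * fderiv ℝ F w Complex.I) / 2

theorem continuous_wirtingerBar {F : ℂ → ℂ} (hF : ContDiff ℝ 1 F) :
    Continuous (wirtingerBar F) := by
  have := hF.continuous_fderiv one_ne_zero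
  unfold wirtingerBar
  fun_prop

theorem hasCompactSupport_wirtingerBar {F : ℂ → ℂ} (hF : HasCompactSupport F) :
    HasCompactSupport (wirtingerBar F) := by
  refine (hF.fderiv ℝ).mono fun w hw => ?_
  contrapose! hw
  simp [wirtingerBar, Function.notMem_support.1 hw]

/-- The Wirtinger derivative in polar coordinates about any centre, where
`e = exp (i θ)`: `2 e⁻¹ ∂F/∂z̄ = ∂F/∂r + (i / r) ∂F/∂θ`. -/
theorem wirtingerBar_div_eq (F : ℂ → ℂ) (w : ℂ) (θ : ℝ) :
    wirtingerBar F w / Complex.exp (θ * Complex.I) =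
      (fderiv ℝ F w (Complex.exp (θ * Complex.I)) +
        Complex.I * fderiv ℝ F w (Complex.I * Complex.exp (θ * Complex.I))) / 2 := by
  have h1 : Complex.exp (θ * Complex.I) = Real.cos θ • (1 : ℂ) + Real.sin θ • Complex.I := by
    rw [Complex.exp_mul_I]; simp
  have h2 : Complex.I * Complex.exp (θ * Complex.I) =
      (-Real.sin θ) • (1 : ℂ) + Real.cos θ • Complex.I := by
    rw [h1]
    simp only [Complex.real_smul, Complex.ofReal_neg]
    linear_combination (Real.sin θ : ℂ) * Complex.I_mul_I
  have h3 : (Real.cos θ : ℂ) ^ 2 + (Real.sin θ : ℂ) ^ 2 = 1 := by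
    exact_mod_cast Real.cos_sq_add_sin_sq θ
  have h4 : ∀ a b : ℝ, fderiv ℝ F w (a • (1 : ℂ) + b • Complex.I) =
      a * fderiv ℝ F w 1 + b * fderiv ℝ F w Complex.I := fun a b => by
    rw [map_add, map_smul, map_smul, Complex.real_smul, Complex.real_smul]
  rw [div_eq_iff (Complex.exp_ne_zero _), h2, h1, h4, h4]
  simp only [wirtingerBar, Complex.real_smul, Complex.ofReal_neg]
  linear_combination (-(fderiv ℝ F w 1 + Complex.I * fderiv ℝ F w Complex.I) / 2) * h3 +
    ((Real.sin θ : ℂ) ^ 2 * fderiv ℝ F w 1 / 2 - (Real.cos θ : ℂ) * Real.sin θ / 2 *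
      fderiv ℝ F w Complex.I) * Complex.I_mul_I

theorem hasDerivAt_radial {F : ℂ → ℂ} (hF : ContDiff ℝ 1 F) (z e : ℂ) (r : ℝ) :
    HasDerivAt (fun r : ℝ => F (z + r * e)) (fderiv ℝ F (z + r * e) e) r := by
  have h1 : HasDerivAt (fun r : ℝ => z + r * e) e r := by
    simpa using ((Complex.ofRealCLM.hasDerivAt (x := r)).mul_const e).const_add z
  exact ((hF.differentiable one_ne_zero).differentiableAt.hasFDerivAt
    (x := z + r * e)).comp_hasDerivAt r h1

theorem hasDerivAt_angular {F : ℂ → ℂ} (hF : ContDiff ℝ 1 F) (z : ℂ) (r θ : ℝ) :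
    HasDerivAt (fun θ : ℝ => F (z + r * Complex.exp (θ * Complex.I)))
      (r * fderiv ℝ F (z + r * Complex.exp (θ * Complex.I))
        (Complex.I * Complex.exp (θ * Complex.I))) θ := by
  have h1 : HasDerivAt (fun θ : ℝ => z + r * Complex.exp (θ * Complex.I))
      (r • (Complex.I * Complex.exp (θ * Complex.I))) θ := by
    have h2 : HasDerivAt (fun θ : ℝ => (θ : ℂ) * Complex.I) Complex.I θ := by
      simpa using (Complex.ofRealCLM.hasDerivAt (x := θ)).mul_const Complex.I
    have h3 := (h2.cexp.const_mul (r : ℂ)).const_add z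
    rwa [mul_comm (Complex.exp _), ← Complex.real_smul] at h3
  have h4 := ((hF.differentiable one_ne_zero).differentiableAt.hasFDerivAt
    (x := z + r * Complex.exp (θ * Complex.I))).comp_hasDerivAt θ h1
  rwa [map_smul, Complex.real_smul] at h4

/-- A continuous function on the strip of polar coordinates is integrable if it vanishes for
large radii. -/
theorem integrableOn_polarCoord_target {A : ℝ × ℝ → ℂ} (hA : Continuous A) {M : ℝ}
    (hM : ∀ p, M < p.1 → A p = 0) : IntegrableOn A (Ioi 0 ×ˢ Ioo (-Real.pi) Real.pi) := by
  have h1 : IntegrableOn A (Icc 0 M ×ˢ Icc (-Real.pi) Real.pi) :=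
    hA.continuousOn.integrableOn_compact (isCompact_Icc.prod isCompact_Icc)
  refine h1.of_forall_sdiff_eq_zero (measurableSet_Ioi.prod measurableSet_Ioo) fun p hp => ?_
  apply hM
  by_contra! h
  exact hp.2 ⟨⟨hp.1.1.le, h⟩, Ioo_subset_Icc_self hp.1.2⟩

/-- The **Cauchy–Pompeiu formula** for compactly supported functions. -/
theorem cauchyPompeiu {F : ℂ → ℂ} (hF : ContDiff ℝ 1 F) (hc : HasCompactSupport F) (z : ℂ) :
    ∫ w, wirtingerBar F w / (w - z) = -Real.pi * F z := by
  have hcont := hF.continuous_fderiv one_ne_zero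
  obtain ⟨M, hM⟩ : ∃ M : ℝ, ∀ r θ : ℝ, M < r →
      z + r * Complex.exp (θ * Complex.I) ∉ tsupport F := by
    obtain ⟨M, hM⟩ := (isBounded_iff_forall_norm_le.1 hc.isBounded)
    refine ⟨max 0 (M + ‖z‖), fun r θ hr hmem => ?_⟩
    have h1 := hM _ hmem
    have h2 : ‖(r : ℂ) * Complex.exp (θ * Complex.I)‖ = r := by
      rw [norm_mul, Complex.norm_exp_ofReal_mul_I, mul_one, Complex.norm_real, Real.norm_of_nonneg]
      exact (le_max_left _ _).trans hr.le
    have h3 := norm_le_add_norm_add ((r : ℂ) * Complex.exp (θ * Complex.I)) z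
    rw [h2, add_comm _ z] at h3
    linarith [le_max_right 0 (M + ‖z‖)]
  have hfd : ∀ r θ : ℝ, M < r → fderiv ℝ F (z + r * Complex.exp (θ * Complex.I)) = 0 := by
    intro r θ hr
    by_contra h
    exact hM r θ hr (support_fderiv_subset ℝ h)
  -- `A = ∂F/∂r` integrates to `-2π F(z)`, by integrating in `r` first;
  -- `A' = (1/r) ∂F/∂θ` integrates to `0`, by integrating in `θ` first.
  let A : ℝ × ℝ → ℂ := fun p => fderiv ℝ F (z + p.1 * Complex.exp (p.2 * Complex.I))
    (Complex.exp (p.2 * Complex.I))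
  let A' : ℝ × ℝ → ℂ := fun p => fderiv ℝ F (z + p.1 * Complex.exp (p.2 * Complex.I))
    (Complex.I * Complex.exp (p.2 * Complex.I))
  have hAc : Continuous A := by
    unfold A
    exact (hcont.comp (by fun_prop)).clm_apply (by fun_prop)
  have hAc' : Continuous A' := by
    unfold A'
    exact (hcont.comp (by fun_prop)).clm_apply (by fun_prop)
  have hA : IntegrableOn A (Ioi 0 ×ˢ Ioo (-Real.pi) Real.pi) :=
    integrableOn_polarCoord_target hAc (M := M) fun p hp => by simp [A, hfd _ _ hp]
  have hA' : IntegrableOn A' (Ioi 0 ×ˢ Ioo (-Real.pi) Real.pi) :=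
    integrableOn_polarCoord_target hAc' (M := M) fun p hp => by simp [A', hfd _ _ hp]
  have e1 : ∫ p in Ioi 0 ×ˢ Ioo (-Real.pi) Real.pi, A p = -(2 * Real.pi) * F z := by
    have h1 : ∀ θ : ℝ, ∫ r in Ioi (0 : ℝ), A (r, θ) = -F z := by
      intro θ
      have h2 : Filter.Tendsto (fun r : ℝ => F (z + r * Complex.exp (θ * Complex.I)))
          Filter.atTop (𝓝 0) := by
        refine tendsto_const_nhds.congr' ?_
        filter_upwards [Filter.eventually_gt_atTop M] with r hr
        exact (image_eq_zero_of_notMem_tsupport (hM r θ hr)).symm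
      have h3 : IntegrableOn (fun r => A (r, θ)) (Ioi 0) := by
        have h4 : IntegrableOn (fun r => A (r, θ)) (Icc 0 M) :=
          (hAc.comp (by fun_prop)).continuousOn.integrableOn_compact isCompact_Icc
        refine h4.of_forall_sdiff_eq_zero measurableSet_Ioi fun r hr => ?_
        have : M < r := by
          by_contra! h
          exact hr.2 ⟨le_of_lt hr.1, h⟩
        simp [A, hfd _ _ this]
      have h5 := integral_Ioi_of_hasDerivAt_of_tendsto
        (hasDerivAt_radial hF z (Complex.exp (θ * Complex.I)) 0).continuousAt.continuousWithinAt
        (fun r _ => hasDerivAt_radial hF z (Complex.exp (θ * Complex.I)) r) h3 h2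
      simpa using h5
    rw [Measure.volume_eq_prod, ← Measure.prod_restrict, integral_prod_symm]
    · simp only [h1]
      rw [setIntegral_const, measureReal_def, Real.volume_Ioo, ENNReal.toReal_ofReal
        (by linarith [Real.pi_pos]), Complex.real_smul]
      push_cast
      ring
    · rwa [Measure.prod_restrict, ← Measure.volume_eq_prod]
  have e2 : ∫ p in Ioi 0 ×ˢ Ioo (-Real.pi) Real.pi, A' p = 0 := by
    rw [Measure.volume_eq_prod, setIntegral_prod]
    · refine (setIntegral_congr_fun measurableSet_Ioi fun r hr => ?_).trans (integral_zero _ _)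
      have h1 := intervalIntegral.integral_eq_sub_of_hasDerivAt (a := -Real.pi) (b := Real.pi)
        (fun θ _ => hasDerivAt_angular hF z r θ)
        (Continuous.intervalIntegrable (by
          have : Continuous fun θ : ℝ => A' (r, θ) := hAc'.comp (by fun_prop)
          exact this.const_mul (r : ℂ)) _ _)
      rw [intervalIntegral.integral_const_mul] at h1
      have h2 : Complex.exp (((-Real.pi : ℝ) : ℂ) * Complex.I) =
          Complex.exp ((Real.pi : ℂ) * Complex.I) := by
        rw [Complex.exp_pi_mul_I]
        push_cast
        rw [neg_mul, Complex.exp_neg, Complex.exp_pi_mul_I]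
        norm_num
      rw [h2, sub_self, mul_eq_zero, or_iff_right (by exact_mod_cast (ne_of_gt hr)),
        intervalIntegral.integral_of_le (by linarith [Real.pi_pos]),
        integral_Ioc_eq_integral_Ioo] at h1
      exact h1
    · rwa [← Measure.volume_eq_prod]
  rw [← integral_add_right_eq_self _ z, ← Complex.integral_comp_polarCoord_symm,
    show polarCoord.target = Ioi 0 ×ˢ Ioo (-Real.pi) Real.pi from rfl]
  have e3 : ∀ p ∈ Ioi (0 : ℝ) ×ˢ Ioo (-Real.pi) Real.pi,
      p.1 • (wirtingerBar F (Complex.polarCoord.symm p + z) / (Complex.polarCoord.symm p + z - z)) =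
        (A p + Complex.I * A' p) / 2 := by
    intro p hp
    have h1 : Complex.polarCoord.symm p = p.1 * Complex.exp (p.2 * Complex.I) := by
      rw [Complex.polarCoord_symm_apply, Complex.exp_mul_I]
      push_cast
      rfl
    have h2 : (p.1 : ℂ) ≠ 0 := by exact_mod_cast (ne_of_gt hp.1)
    rw [h1, add_sub_cancel_right, add_comm _ z, ← wirtingerBar_div_eq, Complex.real_smul]
    field_simp
  rw [setIntegral_congr_fun (measurableSet_Ioi.prod measurableSet_Ioo) e3, integral_div,
    integral_add hA (hA'.const_mul _), integral_const_mul, e1, e2]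
  ring

end CauchyPompeiu

/-! ### Curve integrals as area integrals of Cauchy transforms -/

section CurveGreen

open Set Metric

theorem integrable_indicator_ball_inv_norm :
    Integrable fun w : ℂ => (Iio (1 : ℝ)).indicator (fun r => r⁻¹) ‖w‖ := by
  rw [integrable_fun_norm_addHaar]
  have h1 : IntegrableOn (fun _ : ℝ => (1 : ℝ)) (Ioo 0 1) := by simp
  refine ((integrable_indicator_iff measurableSet_Ioo).2 h1).integrableOn.congr_fun
    (fun r hr => ?_) measurableSet_Ioi
  have hr' : (0 : ℝ) < r := hr
  by_cases h : r < 1 <;> simp [h, hr', hr'.ne']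

/-- The kernel `1 / (w - z)` is integrable against compactly supported continuous functions,
uniformly in `z`. -/
theorem exists_integral_norm_div_sub_le {G : ℂ → ℂ} (hG : Continuous G)
    (hc : HasCompactSupport G) :
    ∃ C : ℝ, ∀ z, Integrable (fun w => G w / (w - z)) ∧ ∫ w, ‖G w / (w - z)‖ ≤ C := by
  obtain ⟨M, hM⟩ := hc.exists_bound_of_continuous hG
  have hM0 : 0 ≤ M := (norm_nonneg _).trans (hM 0)
  have h1 := integrable_indicator_ball_inv_norm
  have h2 : Integrable fun w => ‖G w‖ := (hG.integrable_of_hasCompactSupport hc).norm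
  -- Split the kernel at `|w - z| = 1`: near `z` bound `|G|` by `M`, elsewhere the kernel by `1`.
  let f : ℂ → ℝ := fun w => M * (Iio (1 : ℝ)).indicator (fun r => r⁻¹) ‖w‖
  have hf : ∀ z, Integrable fun w => f (w - z) + ‖G w‖ := fun z =>
    ((h1.const_mul M).comp_sub_right z).add h2
  have hle : ∀ z w, ‖G w / (w - z)‖ ≤ f (w - z) + ‖G w‖ := by
    intro z w
    rw [norm_div]
    rcases lt_or_ge ‖w - z‖ 1 with h | h
    · have e : f (w - z) = M * ‖w - z‖⁻¹ := by simp [f, h]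
      rw [e, div_eq_mul_inv]
      have := mul_le_mul_of_nonneg_right (hM w) (inv_nonneg.2 (norm_nonneg (w - z)))
      linarith [norm_nonneg (G w)]
    · have e : f (w - z) = 0 := by simp [f, h]
      rw [e, zero_add]
      exact div_le_self (norm_nonneg _) h
  have hint : ∀ z, Integrable fun w => G w / (w - z) := fun z =>
    (hf z).mono' (by
      have : Measurable fun w => G w / (w - z) := hG.measurable.div (measurable_id.sub_const z)
      exact this.aestronglyMeasurable) (.of_forall (hle z))
  refine ⟨(∫ w, f w) + ∫ w, ‖G w‖, fun z => ⟨hint z, ?_⟩⟩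
  refine (integral_mono (hint z).norm (hf z) (hle z)).trans_eq ?_
  rw [integral_add ((h1.const_mul M).comp_sub_right z) h2, integral_sub_right_eq_self f z]

theorem exists_norm_deriv_le_of_contDiffOn {c : ℝ → ℂ} (hc : ContDiffOn ℝ 1 c (Icc 0 1)) :
    ∃ L : ℝ, ∀ t ∈ Ioc (0 : ℝ) 1, ‖deriv c t‖ ≤ L := by
  obtain ⟨L, hL⟩ := isCompact_Icc.exists_bound_of_continuousOn
    (hc.continuousOn_derivWithin (uniqueDiffOn_Icc zero_lt_one) le_rfl)
  refine ⟨max L ‖deriv c 1‖, fun t ht => ?_⟩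
  rcases ht.2.lt_or_eq with h | rfl
  · rw [← derivWithin_of_mem_nhds (Icc_mem_nhds ht.1 h)]
    exact (hL t ⟨ht.1.le, h.le⟩).trans (le_max_left _ _)
  · exact le_max_right _ _

/-- The integral `∮ dz / (z - w)` along a path. -/
noncomputable def cauchyIntegral {x y : ℂ} (γ : Path x y) (w : ℂ) : ℂ :=
  curveIntegral (fun z => (z - w)⁻¹ • (1 : ℂ →L[ℂ] ℂ)) γ

variable {x y : ℂ} {γ : Path x y}

theorem cauchyIntegral_eq (γ : Path x y) (w : ℂ) :
    cauchyIntegral γ w = ∫ t in (0 : ℝ)..1, (γ.extend t - w)⁻¹ * deriv γ.extend t := by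
  rw [cauchyIntegral, curveIntegral_eq_intervalIntegral_deriv]
  simp

/-- Integrating the Cauchy–Pompeiu formula along a path. -/
theorem integrable_and_curveIntegral_eq (hγ : ContDiffOn ℝ 1 γ.extend (Icc 0 1)) {F : ℂ → ℂ}
    (hF : ContDiff ℝ 1 F) (hc : HasCompactSupport F) :
    Integrable (fun w => wirtingerBar F w * cauchyIntegral γ w) ∧
      ∫ w, wirtingerBar F w * cauchyIntegral γ w =
        Real.pi * curveIntegral (fun z => F z • (1 : ℂ →L[ℂ] ℂ)) γ := by
  have hG := continuous_wirtingerBar hF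
  obtain ⟨C, hC⟩ := exists_integral_norm_div_sub_le hG (hasCompactSupport_wirtingerBar hc)
  obtain ⟨L, hL⟩ := exists_norm_deriv_le_of_contDiffOn hγ
  have hL0 : 0 ≤ L := (norm_nonneg _).trans (hL 1 ⟨zero_lt_one, le_rfl⟩)
  let H : ℝ → ℂ → ℂ := fun t w => wirtingerBar F w / (w - γ.extend t) * deriv γ.extend t
  have hHm : Measurable (Function.uncurry H) :=
    ((hG.measurable.comp measurable_snd).div (measurable_snd.sub
      (γ.continuous_extend.measurable.comp measurable_fst))).mul
      ((measurable_deriv _).comp measurable_fst)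
  have hH : Integrable (Function.uncurry H) ((volume.restrict (Ioc 0 1)).prod volume) := by
    rw [integrable_prod_iff hHm.aestronglyMeasurable]
    refine ⟨.of_forall fun t => (hC (γ.extend t)).1.mul_const (deriv γ.extend t), ?_⟩
    have hm : AEStronglyMeasurable (fun t => ∫ w, ‖Function.uncurry H (t, w)‖)
        (volume.restrict (Ioc 0 1)) :=
      hHm.norm.stronglyMeasurable.integral_prod_right.aestronglyMeasurable
    refine Integrable.mono' (integrable_const (C * L)) hm ?_
    refine (ae_restrict_iff' measurableSet_Ioc).2 (.of_forall fun t ht => ?_)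
    have h1 : ∫ w, ‖Function.uncurry H (t, w)‖ =
        (∫ w, ‖wirtingerBar F w / (w - γ.extend t)‖) * ‖deriv γ.extend t‖ := by
      rw [← integral_mul_const]
      simp [H, Function.uncurry]
    rw [h1, Real.norm_of_nonneg (by positivity)]
    exact mul_le_mul (hC _).2 (hL t ht) (norm_nonneg _)
      ((integral_nonneg fun _ => norm_nonneg _).trans (hC 0).2)
  have hw : ∀ w, ∫ t in Ioc (0 : ℝ) 1, H t w = -(wirtingerBar F w * cauchyIntegral γ w) := by
    intro w
    rw [cauchyIntegral_eq, intervalIntegral.integral_of_le zero_le_one, ← integral_const_mul,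
      ← integral_neg]
    refine integral_congr_ae (.of_forall fun t => ?_)
    simp only [H]
    rw [← neg_sub (γ.extend t) w, div_neg, div_eq_mul_inv]
    ring
  have hswap := integral_integral_swap hH
  simp only [hw] at hswap
  refine ⟨?_, ?_⟩
  · have h1 := hH.integral_prod_right.neg
    refine h1.congr (.of_forall fun w => ?_)
    change -(∫ t in Ioc (0 : ℝ) 1, H t w) = _
    rw [hw, neg_neg]
  · rw [integral_neg, ← neg_eq_iff_eq_neg] at hswap
    rw [← hswap, curveIntegral_eq_intervalIntegral_deriv,
      intervalIntegral.integral_of_le zero_le_one, ← integral_const_mul, ← integral_neg]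
    refine integral_congr_ae (.of_forall fun t => ?_)
    simp only [H, integral_mul_const, cauchyPompeiu hF hc]
    simp
    ring

/-- A `C¹` path in the plane is a null set: it is the image of a strip under a map whose
derivative has rank at most one. -/
theorem volume_range_eq_zero (hγ : ContDiffOn ℝ 1 γ.extend (Icc 0 1)) :
    volume (range γ) = 0 := by
  let s : Set ℂ := Complex.re ⁻¹' Icc 0 1
  have h1 : range γ ⊆ (fun z : ℂ => γ.extend z.re) '' s := by
    rintro _ ⟨t, rfl⟩
    exact ⟨(t : ℝ), t.2, by simp⟩
  refine measure_mono_null h1 (addHaar_image_eq_zero_of_det_fderivWithin_eq_zero volume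
    (f' := fun z => (ContinuousLinearMap.toSpanSingleton ℝ
      (derivWithin γ.extend (Icc 0 1) z.re)).comp Complex.reCLM) (fun z hz => ?_) fun z _ => ?_)
  · have h2 := ((hγ.differentiableOn one_ne_zero) z.re hz).hasDerivWithinAt.hasFDerivWithinAt
    exact h2.comp z Complex.reCLM.hasFDerivAt.hasFDerivWithinAt fun w hw => hw
  · by_contra h
    have h3 := LinearMap.ker_eq_bot.1 ((LinearMap.equivOfDetNeZero _ h).ker)
    have h4 : (Complex.I : ℂ) = 0 := h3 (by simp)
    exact Complex.I_ne_zero h4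

theorem continuousAt_cauchyIntegral (hγ : ContDiffOn ℝ 1 γ.extend (Icc 0 1)) {w : ℂ}
    (hw : w ∉ range γ) : ContinuousAt (cauchyIntegral γ) w := by
  obtain ⟨L, hL⟩ := exists_norm_deriv_le_of_contDiffOn hγ
  have hL0 : 0 ≤ L := (norm_nonneg _).trans (hL 1 ⟨zero_lt_one, le_rfl⟩)
  have hcl : IsClosed (range γ) := (isCompact_range γ.continuous).isClosed
  obtain ⟨r, hr, hball⟩ := Metric.isOpen_iff.1 hcl.isOpen_compl w hw
  have hmem : ∀ t, γ.extend t ∈ range γ := fun t => by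
    rw [← γ.extend_range]; exact mem_range_self t
  have hdist : ∀ v ∈ ball w (r / 2), ∀ t, r / 2 ≤ ‖γ.extend t - v‖ := by
    intro v hv t
    by_contra! h
    refine hball ?_ (hmem t)
    rw [mem_ball] at hv ⊢
    rw [← dist_eq_norm] at h
    linarith [dist_triangle (γ.extend t) v w]
  have h0 : cauchyIntegral γ = fun w => ∫ t in (0 : ℝ)..1, (γ.extend t - w)⁻¹ * deriv γ.extend t :=
    funext (cauchyIntegral_eq γ)
  rw [h0]
  refine intervalIntegral.continuousAt_of_dominated_interval (bound := fun _ => (r / 2)⁻¹ * L)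
    (.of_forall fun v => ?_) ?_ (by simp) (.of_forall fun t _ => ?_)
  · exact (((γ.continuous_extend.measurable.sub_const v).inv).mul
      (measurable_deriv _)).aestronglyMeasurable
  · filter_upwards [ball_mem_nhds w (half_pos hr)] with v hv
    refine .of_forall fun t ht => ?_
    rw [uIoc_of_le zero_le_one] at ht
    rw [norm_mul, norm_inv]
    exact mul_le_mul (inv_anti₀ (half_pos hr) (hdist v hv t)) (hL t ht) (norm_nonneg _)
      (by positivity)
  · have : γ.extend t - w ≠ 0 := sub_ne_zero.2 fun h => hw (h ▸ hmem t)
    exact ((continuousAt_const.sub continuousAt_id).inv₀ this).mul continuousAt_const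

theorem tendsto_cauchyIntegral_cocompact (hγ : ContDiffOn ℝ 1 γ.extend (Icc 0 1)) :
    Filter.Tendsto (cauchyIntegral γ) (Filter.cocompact ℂ) (𝓝 0) := by
  obtain ⟨L, hL⟩ := exists_norm_deriv_le_of_contDiffOn hγ
  have hL0 : 0 ≤ L := (norm_nonneg _).trans (hL 1 ⟨zero_lt_one, le_rfl⟩)
  obtain ⟨M, hM⟩ := isBounded_iff_forall_norm_le.1 (isCompact_range γ.continuous).isBounded
  have hmem : ∀ t, ‖γ.extend t‖ ≤ M := fun t => hM _ (by
    rw [← γ.extend_range]; exact mem_range_self t)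
  have h1 : Filter.Tendsto (fun w : ℂ => (‖w‖ - M)⁻¹ * L) (Filter.cocompact ℂ) (𝓝 0) := by
    have h2 : Filter.Tendsto (fun w : ℂ => ‖w‖ - M) (Filter.cocompact ℂ) Filter.atTop :=
      Filter.tendsto_atTop_add_const_right _ _ (tendsto_norm_cocompact_atTop)
    simpa using (tendsto_inv_atTop_zero.comp h2).mul_const L
  refine squeeze_zero_norm' ?_ h1
  filter_upwards [tendsto_norm_cocompact_atTop.eventually_gt_atTop M] with w hw
  rw [cauchyIntegral_eq]
  refine (intervalIntegral.norm_integral_le_of_norm_le_const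
    (C := (‖w‖ - M)⁻¹ * L) fun t ht => ?_).trans_eq (by simp)
  rw [uIoc_of_le zero_le_one] at ht
  rw [norm_mul, norm_inv]
  refine mul_le_mul (inv_anti₀ (by linarith) ?_) (hL t ht) (norm_nonneg _)
    (inv_nonneg.2 (by linarith))
  have := norm_sub_norm_le w (γ.extend t)
  rw [norm_sub_rev]
  linarith [hmem t]

end CurveGreen

/-! ### Green's formula for chains with prescribed winding number -/

section WindingGreen

open Set Metric

/-- A compact subset of an open set has a `C¹`, compactly supported cut-off function. -/
theorem exists_contDiff_cutoff {K Y : Set ℂ} (hK : IsCompact K) (hY : IsOpen Y) (hKY : K ⊆ Y) :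
    ∃ χ : ℂ → ℝ, ContDiff ℝ 1 χ ∧ HasCompactSupport χ ∧ tsupport χ ⊆ Y ∧ ∀ᶠ w in 𝓝ˢ K, χ w = 1 := by
  obtain ⟨L, hL, hKL, hLY⟩ := exists_compact_between hK hY hKY
  obtain ⟨χ, h1, h0, -⟩ := exists_contMDiffMap_one_nhds_of_subset_interior (n := 1) 𝓘(ℝ, ℂ)
    hK.isClosed hKL
  have hs : tsupport χ ⊆ L := closure_minimal (fun w hw => by
    by_contra h
    exact hw (h0 w h)) hL.isClosed
  exact ⟨χ, χ.contMDiff.contDiff, HasCompactSupport.of_support_subset_isCompact hL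
    (subset_closure.trans hs), hs.trans hLY, h1⟩

theorem contDiff_smul_of_tsupport_subset {F : ℂ → ℂ} {χ : ℂ → ℝ} {Y : Set ℂ} (hY : IsOpen Y)
    (hF : ContDiffOn ℝ 1 F Y) (hχ : ContDiff ℝ 1 χ) (hs : tsupport χ ⊆ Y) :
    ContDiff ℝ 1 fun w => χ w • F w := by
  rw [contDiff_iff_contDiffAt]
  intro w
  by_cases hw : w ∈ tsupport χ
  · exact hχ.contDiffAt.smul (hF.contDiffAt (hY.mem_nhds (hs hw)))
  · refine (contDiffAt_const (c := (0 : ℂ))).congr_of_eventuallyEq ?_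
    filter_upwards [(isClosed_tsupport χ).isOpen_compl.mem_nhds hw] with v hv
    rw [image_eq_zero_of_notMem_tsupport hv, zero_smul]

variable {ι : Type*} [Fintype ι] {c : ι → Σ p : ℂ × ℂ, Path p.1 p.2} {ε : ι → ℂ} {E Y : Set ℂ}

/-- The region enclosed by a closed chain in the sense of winding numbers is, together with the
chain, compact: its complement consists of the points off the chain with winding number `≠ 1`. -/
theorem isCompact_union_of_winding (hc : ∀ i, ContDiffOn ℝ 1 (c i).2.extend (Icc 0 1))
    (hw : ∀ w, (∀ i, w ∉ range (c i).2) →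
      ∑ i, ε i * cauchyIntegral (c i).2 w = E.indicator (fun _ => 2 * Real.pi * Complex.I) w) :
    IsCompact (E ∪ ⋃ i, range (c i).2) := by
  have hΓ : IsCompact (⋃ i, range (c i).2) :=
    isCompact_iUnion fun i => isCompact_range (c i).2.continuous
  have h2 : (2 * Real.pi * Complex.I : ℂ) ≠ 0 := Complex.two_pi_I_ne_zero
  have hoff : ∀ w, w ∉ ⋃ i, range (c i).2 → ∀ i, w ∉ range (c i).2 := fun w h i hi =>
    h (mem_iUnion.2 ⟨i, hi⟩)
  refine Metric.isCompact_of_isClosed_isBounded ?_ ?_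
  · rw [← isOpen_compl_iff, isOpen_iff_mem_nhds]
    intro w hwm
    rw [mem_compl_iff, mem_union, not_or] at hwm
    have hcont : ContinuousAt (fun w => ∑ i, ε i * cauchyIntegral (c i).2 w) w :=
      tendsto_finsetSum _ fun i _ =>
        continuousAt_const.mul (continuousAt_cauchyIntegral (hc i) (hoff w hwm.2 i))
    have h0 : ∑ i, ε i * cauchyIntegral (c i).2 w ≠ 2 * Real.pi * Complex.I := by
      rw [hw w (hoff w hwm.2), indicator_of_notMem hwm.1]
      exact h2.symm
    filter_upwards [hcont.eventually_ne h0, hΓ.isClosed.isOpen_compl.mem_nhds hwm.2] with v hv hv'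
    rw [mem_compl_iff, mem_union, not_or]
    refine ⟨fun hE => hv ?_, hv'⟩
    rw [hw v (hoff v hv'), indicator_of_mem hE]
  · have ht : Filter.Tendsto (fun w => ∑ i, ε i * cauchyIntegral (c i).2 w) (Filter.cocompact ℂ)
        (𝓝 0) := by
      have := tendsto_finsetSum Finset.univ fun i _ =>
        (tendsto_cauchyIntegral_cocompact (hc i)).const_mul (ε i)
      simpa using this
    refine Bornology.IsBounded.union ?_ hΓ.isBounded
    have h3 : ∀ᶠ w in Filter.cocompact ℂ, w ∉ E := by
      filter_upwards [ht.eventually_ne h2.symm, hΓ.compl_mem_cocompact] with w h4 h5 hE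
      rw [hw w (hoff w h5), indicator_of_mem hE] at h4
      exact h4 rfl
    rw [← Bornology.isCobounded_compl_iff, Bornology.isCobounded_def, Metric.cobounded_eq_cocompact]
    exact h3

/-- **Green's formula** for a `C¹` chain whose winding number off the chain is the indicator
function of a set `E`. -/
theorem integrableOn_and_sum_curveIntegral_eq (hY : IsOpen Y) (hEY : E ⊆ Y)
    (hc : ∀ i, ContDiffOn ℝ 1 (c i).2.extend (Icc 0 1)) (hcY : ∀ i, range (c i).2 ⊆ Y)
    (hw : ∀ w, (∀ i, w ∉ range (c i).2) →
      ∑ i, ε i * cauchyIntegral (c i).2 w = E.indicator (fun _ => 2 * Real.pi * Complex.I) w)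
    {F : ℂ → ℂ} (hF : ContDiffOn ℝ 1 F Y) :
    IntegrableOn (wirtingerBar F) E ∧
      ∑ i, ε i * curveIntegral (fun z => F z • (1 : ℂ →L[ℂ] ℂ)) (c i).2 =
        2 * Complex.I * ∫ w in E, wirtingerBar F w := by
  have hK := isCompact_union_of_winding hc hw
  have hΓ0 : volume (⋃ i, range (c i).2) = 0 :=
    measure_iUnion_null fun i => volume_range_eq_zero (hc i)
  have hEK : (E ∪ ⋃ i, range (c i).2 : Set ℂ) =ᵐ[volume] E :=
    union_ae_eq_left_of_ae_eq_empty (ae_eq_empty.2 hΓ0)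
  have hE : NullMeasurableSet E := ⟨_, hK.measurableSet, hEK.symm⟩
  obtain ⟨χ, hχ, hχc, hχY, hχ1⟩ := exists_contDiff_cutoff hK hY
    (union_subset hEY (iUnion_subset hcY))
  let F' : ℂ → ℂ := fun w => χ w • F w
  have hF' : ContDiff ℝ 1 F' := contDiff_smul_of_tsupport_subset hY hF hχ hχY
  have hFc : HasCompactSupport F' := hχc.smul_right
  have hFF : ∀ w ∈ E ∪ ⋃ i, range (c i).2, F' =ᶠ[𝓝 w] F := by
    intro w hwK
    filter_upwards [hχ1.filter_mono (nhds_le_nhdsSet hwK)] with v hv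
    simp [F', hv]
  have hcur : ∀ i, curveIntegral (fun z => F' z • (1 : ℂ →L[ℂ] ℂ)) (c i).2 =
      curveIntegral (fun z => F z • (1 : ℂ →L[ℂ] ℂ)) (c i).2 := by
    intro i
    rw [curveIntegral_eq_intervalIntegral_deriv, curveIntegral_eq_intervalIntegral_deriv]
    refine intervalIntegral.integral_congr fun t _ => ?_
    have h1 : (c i).2.extend t ∈ E ∪ ⋃ i, range (c i).2 := by
      refine Or.inr (mem_iUnion.2 ⟨i, ?_⟩)
      rw [← Path.extend_range]
      exact mem_range_self t
    simp only [(hFF _ h1).eq_of_nhds]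
  have hae : ∀ᵐ w, ∑ i, ε i * (wirtingerBar F' w * cauchyIntegral (c i).2 w) =
      E.indicator (fun w => wirtingerBar F w * (2 * Real.pi * Complex.I)) w := by
    filter_upwards [compl_mem_ae_iff.2 hΓ0] with w hwΓ
    have h1 := hw w fun i hi => hwΓ (mem_iUnion.2 ⟨i, hi⟩)
    have h2 : ∑ i, ε i * (wirtingerBar F' w * cauchyIntegral (c i).2 w) =
        wirtingerBar F' w * ∑ i, ε i * cauchyIntegral (c i).2 w := by
      rw [Finset.mul_sum]
      exact Finset.sum_congr rfl fun _ _ => by ring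
    rw [h2, h1]
    by_cases hwE : w ∈ E
    · rw [indicator_of_mem hwE, indicator_of_mem hwE]
      simp only [wirtingerBar, (hFF w (Or.inl hwE)).fderiv_eq]
    · rw [indicator_of_notMem hwE, indicator_of_notMem hwE, mul_zero]
  have hint : ∀ i, Integrable fun w => ε i * (wirtingerBar F' w * cauchyIntegral (c i).2 w) :=
    fun i => (integrable_and_curveIntegral_eq (hc i) hF' hFc).1.const_mul _
  have hint2 : IntegrableOn (fun w => wirtingerBar F w * (2 * Real.pi * Complex.I)) E := by
    rw [← integrableOn_congr_set_ae hEK, ← integrable_indicator_iff hK.measurableSet]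
    exact (integrable_finsetSum _ fun i _ => hint i).congr
      (Filter.EventuallyEq.trans hae (indicator_ae_eq_of_ae_eq_set hEK.symm))
  refine ⟨?_, ?_⟩
  · have h1 := hint2.mul_const (2 * Real.pi * Complex.I : ℂ)⁻¹
    refine h1.congr (.of_forall fun w => ?_)
    exact mul_inv_cancel_right₀ Complex.two_pi_I_ne_zero _
  · have h1 := integral_congr_ae hae
    rw [integral_finsetSum _ fun i _ => hint i, integral_indicator₀ hE, integral_mul_const] at h1
    simp only [integral_const_mul, (integrable_and_curveIntegral_eq (hc _) hF' hFc).2, hcur] at h1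
    have hpi : (Real.pi : ℂ) ≠ 0 := by exact_mod_cast Real.pi_ne_zero
    apply mul_left_cancel₀ hpi
    rw [Finset.mul_sum]
    rw [← Finset.sum_congr rfl fun i _ => mul_left_comm (ε i) (Real.pi : ℂ) _, h1]
    ring

end WindingGreen

/-! ### Stokes' formula on the fundamental polygon -/

section Polygon

open Set

variable {V : Type} [NormedAddCommGroup V] [NormedSpace ℂ V] [FiniteDimensional ℂ V]

/-- A sesquilinear form on a finite-dimensional space as a continuous real bilinear map. -/
noncomputable def LinearMap.toRealBilinear (B : V →ₗ[ℂ] V →ₗ⋆[ℂ] ℂ) : V →L[ℝ] V →L[ℝ] ℂ :=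
  (LinearMap.mk₂ ℝ (fun v w => B v w) (by simp) (fun c v w => by
    rw [← Complex.coe_smul, map_smul, LinearMap.smul_apply, Complex.coe_smul]) (by simp)
    (fun c v w => by
      rw [← Complex.coe_smul, map_smulₛₗ, Complex.conj_ofReal, Complex.coe_smul])
    ).toContinuousBilinearMap

@[simp] theorem LinearMap.toRealBilinear_apply (B : V →ₗ[ℂ] V →ₗ⋆[ℂ] ℂ) (v w : V) :
    B.toRealBilinear v w = B v w := rfl

theorem contDiffOn_sesquilinear (B : V →ₗ[ℂ] V →ₗ⋆[ℂ] ℂ) {Y : Set ℂ} (hY : IsOpen Y)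
    {h f : ℂ → V} (hh : DifferentiableOn ℂ h Y) (hf : DifferentiableOn ℂ f Y) :
    ContDiffOn ℝ 1 (fun z => B (h z) (f z)) Y := by
  have : CompleteSpace V := FiniteDimensional.complete ℂ V
  have h1 : ContDiffOn ℝ 1 h Y := (hh.contDiffOn hY).restrict_scalars ℝ
  have h2 : ContDiffOn ℝ 1 f Y := (hf.contDiffOn hY).restrict_scalars ℝ
  exact (B.toRealBilinear.contDiff.comp_contDiffOn h1).clm_apply h2

/-- Only the conjugate-linear slot contributes to the `∂/∂z̄` derivative of a sesquilinear
expression in holomorphic functions. -/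
theorem wirtingerBar_sesquilinear (B : V →ₗ[ℂ] V →ₗ⋆[ℂ] ℂ) {h f : ℂ → V} {h' f' : V} {z : ℂ}
    (hh : HasDerivAt h h' z) (hf : HasDerivAt f f' z) :
    wirtingerBar (fun z => B (h z) (f z)) z = B (h z) f' := by
  have h1 := B.toRealBilinear.hasFDerivAt_of_bilinear
    (hh.hasFDerivAt.restrictScalars ℝ) (hf.hasFDerivAt.restrictScalars ℝ)
  have h2 : HasFDerivAt (fun z => B (h z) (f z)) _ z := h1
  rw [wirtingerBar, h2.fderiv]
  simp
  linear_combination ((B h') (f z) - (B (h z)) f') / 2 * Complex.I_mul_I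

variable {g : ℕ} {X : Type*} [TopologicalSpace X] [ChartedSpace ℂ X]

namespace UniformizedSurface

variable (S : UniformizedSurface g X) {σ : Representation ℂ (SurfaceGroup g) V}

theorem differentiableOn_deck (γ : SurfaceGroup g) : DifferentiableOn ℂ (S.deck γ) S.Y :=
  fun z hz => (S.hasDerivAt_deck γ ⟨z, hz⟩).differentiableAt.differentiableWithinAt

variable {S}

theorem measurableEmbedding_val : MeasurableEmbedding (Subtype.val : S.Y → ℂ) :=
  .subtype_coe S.Y.isOpen.measurableSet

theorem restrict_map_area (D : Set S.Y) :
    (S.area.map Subtype.val).restrict (Subtype.val '' D) = volume.restrict (Subtype.val '' D) := by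
  rw [area, measurableEmbedding_val.map_comap,
    Measure.restrict_restrict_of_subset (image_subset_range _ _)]

theorem integrableOn_area_iff (f : ℂ → ℂ) (D : Set S.Y) :
    IntegrableOn (fun z : S.Y => f z) D S.area ↔ IntegrableOn f (Subtype.val '' D) := by
  have h := measurableEmbedding_val.integrableOn_map_iff (f := f) (μ := S.area)
    (s := Subtype.val '' D)
  rw [preimage_image_eq _ Subtype.val_injective] at h
  rw [IntegrableOn, IntegrableOn, ← restrict_map_area]
  exact h.symm

theorem setIntegral_area (f : ℂ → ℂ) (D : Set S.Y) :
    ∫ z in D, f z ∂S.area = ∫ z in Subtype.val '' D, f z := by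
  have h := measurableEmbedding_val.setIntegral_map (μ := S.area) f (Subtype.val '' D)
  rw [preimage_image_eq _ Subtype.val_injective, restrict_map_area] at h
  exact h.symm

theorem translate_extend (γ : SurfaceGroup g) {z w : S.Y} (c : Path z w) (t : ℝ) :
    (S.translate γ c).extend t = S.deck γ (c.extend t) :=
  (S.deck_coe γ (c.extend t)).symm

theorem range_translate_subset (γ : SurfaceGroup g) {z w : S.Y} (c : Path z w) :
    range (S.translate γ c) ⊆ S.Y := by
  rintro _ ⟨t, rfl⟩
  exact (γ • c t : S.Y).2

theorem contDiffOn_translate (γ : SurfaceGroup g) {z w : S.Y} {c : Path z w}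
    (hc : ContDiffOn ℝ 1 (fun t : ℝ => (c.extend t : ℂ)) (Icc 0 1)) :
    ContDiffOn ℝ 1 (S.translate γ c).extend (Icc 0 1) := by
  have h1 : ContDiffOn ℝ 1 (S.deck γ) S.Y :=
    ((S.differentiableOn_deck γ).contDiffOn S.Y.isOpen).restrict_scalars ℝ
  exact (h1.comp hc fun t _ => (c.extend t).2).congr fun t _ => translate_extend γ c t

/-- Change of variables in a curve integral along a translated path. -/
theorem curveIntegral_translate (γ : SurfaceGroup g) {z w : S.Y} {c : Path z w}
    (hc : ContDiffOn ℝ 1 (fun t : ℝ => (c.extend t : ℂ)) (Icc 0 1)) {F F' : ℂ → ℂ}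
    (hF : ∀ z : S.Y, deriv (S.deck γ) z * F (S.deck γ z) = F' z) :
    curveIntegral (fun z => F z • (1 : ℂ →L[ℂ] ℂ)) (S.translate γ c) =
      curveIntegral (fun z => F' z • (1 : ℂ →L[ℂ] ℂ)) (c.map continuous_subtype_val) := by
  rw [curveIntegral_eq_intervalIntegral_deriv, curveIntegral_eq_intervalIntegral_deriv,
    intervalIntegral.integral_of_le zero_le_one, intervalIntegral.integral_of_le zero_le_one,
    integral_Ioc_eq_integral_Ioo, integral_Ioc_eq_integral_Ioo]
  refine setIntegral_congr_fun measurableSet_Ioo fun t ht => ?_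
  have h1 : DifferentiableAt ℝ (fun t : ℝ => (c.extend t : ℂ)) t :=
    (hc.differentiableOn one_ne_zero).differentiableAt (Icc_mem_nhds ht.1 ht.2)
  have h2 := HasDerivAt.scomp t (S.hasDerivAt_deck γ (c.extend t)) h1.hasDerivAt
  have e1 : (S.translate γ c).extend = S.deck γ ∘ fun t : ℝ => (c.extend t : ℂ) :=
    funext (translate_extend γ c)
  have e2 : (c.map continuous_subtype_val).extend = fun t : ℝ => (c.extend t : ℂ) := rfl
  simp only [e1, e2, h2.deriv, Function.comp_apply, _root_.smul_apply,
    one_apply_eq_self, smul_eq_mul, ← hF (c.extend t)]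
  ring

/-- Curve integrals of scalar forms `ℓ (h(z)) dz`. -/
theorem curveIntegral_clm_comp (h : S.holomorphicForms σ) (ℓ : V →ₗ[ℂ] ℂ) {z w : S.Y}
    {c : Path z w} (hc : ContDiffOn ℝ 1 (fun t : ℝ => (c.extend t : ℂ)) (Icc 0 1)) :
    CurveIntegrable (fun z => ℓ (h.1 z) • (1 : ℂ →L[ℂ] ℂ)) (c.map continuous_subtype_val) ∧
    curveIntegral (fun z => ℓ (h.1 z) • (1 : ℂ →L[ℂ] ℂ)) (c.map continuous_subtype_val) =
      ℓ (S.integral h z w) := by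
  have hc' : ContDiffOn ℝ 1 (c.map continuous_subtype_val).extend (Icc 0 1) := hc
  have hℓ : DifferentiableOn ℂ (fun z => ℓ (h.1 z)) S.Y :=
    (LinearMap.toContinuousLinearMap ℓ).differentiable.comp_differentiableOn h.2.1
  have hcont : ContinuousOn (fun z => ℓ (h.1 z) • (1 : ℂ →L[ℂ] ℂ)) S.Y :=
    hℓ.continuousOn.smul continuousOn_const
  have hint : CurveIntegrable (fun z => ℓ (h.1 z) • (1 : ℂ →L[ℂ] ℂ))
      (c.map continuous_subtype_val) :=
    hcont.curveIntegrable_of_contDiffOn hc' fun t => (c t).2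
  refine ⟨hint, ?_⟩
  have h1 : ∀ z : S.Y, HasDerivAt (fun z => ℓ (S.primitive h z)) (ℓ (h.1 z)) z := fun z =>
    (LinearMap.toContinuousLinearMap ℓ).hasFDerivAt.comp_hasDerivAt (z : ℂ)
      (S.hasDerivAt_primitive h z)
  rw [CurveIntegrable] at hint
  rw [curveIntegral_def, intervalIntegral.integral_eq_sub_of_hasDerivAt_of_le zero_le_one
    (f := fun t => ℓ (S.primitive h (c.extend t))) _ _ hint]
  · simp [integral]
  · have h2 : ContinuousOn (fun z => ℓ (S.primitive h z)) S.Y :=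
      fun z hz => (h1 ⟨z, hz⟩).continuousAt.continuousWithinAt
    exact h2.comp hc.continuousOn fun t _ => (c.extend t).2
  · intro t ht
    have h2 : DifferentiableAt ℝ (c.map continuous_subtype_val).extend t :=
      (hc'.differentiableOn one_ne_zero).differentiableAt (Icc_mem_nhds ht.1 ht.2)
    have h3 := HasDerivAt.scomp t (h1 (c.extend t)) h2.hasDerivAt
    rw [curveIntegralFun_def, derivWithin_of_mem_nhds (Icc_mem_nhds ht.1 ht.2)]
    rw [_root_.smul_apply, one_apply_eq_self, smul_eq_mul, mul_comm]
    exact h3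

/-- The effect of a deck transformation on `∫ ⟨h, f⟩ dz`, where `f = ∫_{z₀} k dz`. The defect is
a value of the form `B` on periods of `h` and `k`. -/
theorem curveIntegral_translate_sesquilinear {B : V →ₗ[ℂ] V →ₗ⋆[ℂ] ℂ}
    (hB : ∀ γ v w, B (σ γ v) (σ γ w) = B v w) (h k : S.holomorphicForms σ) (z₀ : S.Y)
    (γ : SurfaceGroup g) {z w : S.Y} {c : Path z w}
    (hc : ContDiffOn ℝ 1 (fun t : ℝ => (c.extend t : ℂ)) (Icc 0 1)) :
    curveIntegral (fun z => B (h.1 z) (S.primitive k z - S.primitive k z₀) • (1 : ℂ →L[ℂ] ℂ))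
        (S.translate γ c) =
      curveIntegral (fun z => B (h.1 z) (S.primitive k z - S.primitive k z₀) • (1 : ℂ →L[ℂ] ℂ))
        (c.map continuous_subtype_val) -
      B (S.integral h z w) (S.periodCocycle σ z₀ k γ⁻¹) := by
  have hdiff : DifferentiableOn ℂ (fun z => S.primitive k z - S.primitive k z₀) S.Y := fun z hz =>
    ((S.hasDerivAt_primitive k ⟨z, hz⟩).differentiableAt.sub_const _).differentiableWithinAt
  have hcont : ContinuousOn (fun z => B (h.1 z) (S.primitive k z - S.primitive k z₀) •
      (1 : ℂ →L[ℂ] ℂ)) S.Y :=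
    (contDiffOn_sesquilinear B S.Y.isOpen h.2.1 hdiff).continuousOn.smul continuousOn_const
  have hint : CurveIntegrable (fun z => B (h.1 z) (S.primitive k z - S.primitive k z₀) •
      (1 : ℂ →L[ℂ] ℂ)) (c.map continuous_subtype_val) :=
    hcont.curveIntegrable_of_contDiffOn (by exact hc) fun t => (c t).2
  have hℓ := curveIntegral_clm_comp h (B.flip (S.periodCocycle σ z₀ k γ⁻¹)) hc
  rw [← LinearMap.flip_apply B, ← hℓ.2, ← curveIntegral_fun_sub hint hℓ.1]
  simp only [← sub_smul]
  refine curveIntegral_translate γ hc fun u => ?_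
  have e1 : S.primitive k (S.deck γ u) - S.primitive k z₀ =
      σ γ (S.primitive k u - S.primitive k z₀ - S.periodCocycle σ z₀ k γ⁻¹) := by
    have h1 := S.integral_smul k γ (γ⁻¹ • z₀) u
    rw [smul_inv_smul] at h1
    rw [S.deck_coe]
    refine h1.trans (congrArg (σ γ) ?_)
    change S.primitive k u - S.primitive k _ = S.primitive k u - S.primitive k z₀ -
      (S.primitive k _ - S.primitive k z₀)
    abel
  rw [e1, S.deck_coe, ← smul_eq_mul, ← LinearMap.smul_apply, ← map_smul, h.2.2.2 γ u, hB, map_sub,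
    LinearMap.flip_apply]

namespace FundamentalPolygon

variable (P : S.FundamentalPolygon)

/-- The sides of the polygon. The index `(j, m)` stands for the `m`-th side after the vertex
`R g j • z₀`; the last two sides are parametrised against the orientation of the boundary. -/
noncomputable def side (i : Fin g × Fin 4) : Σ p : ℂ × ℂ, Path p.1 p.2 :=
  ![⟨(_, _), S.translate (SurfaceGroup.R g i.1) (P.a i.1)⟩,
    ⟨(_, _), S.translate (SurfaceGroup.R g i.1 * SurfaceGroup.α i.1) (P.b i.1)⟩,
    ⟨(_, _), S.translate (SurfaceGroup.R g (i.1 + 1) * SurfaceGroup.β i.1) (P.a i.1)⟩,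
    ⟨(_, _), S.translate (SurfaceGroup.R g (i.1 + 1)) (P.b i.1)⟩] i.2

/-- The orientation, `1` or `-1`, with which a side occurs in the boundary of the polygon. -/
def sign (i : Fin g × Fin 4) : ℂ := ![1, 1, -1, -1] i.2

theorem contDiffOn_side (i : Fin g × Fin 4) :
    ContDiffOn ℝ 1 (P.side i).2.extend (Icc 0 1) := by
  obtain ⟨j, m⟩ := i
  fin_cases m
  · exact contDiffOn_translate _ (P.a_contDiff j)
  · exact contDiffOn_translate _ (P.b_contDiff j)
  · exact contDiffOn_translate _ (P.a_contDiff j)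
  · exact contDiffOn_translate _ (P.b_contDiff j)

theorem range_side_subset (i : Fin g × Fin 4) : range (P.side i).2 ⊆ S.Y := by
  obtain ⟨j, m⟩ := i
  fin_cases m <;> exact range_translate_subset _ _

theorem sum_cauchyIntegral_side (w : ℂ) (hw : ∀ i, w ∉ range (P.side i).2) :
    ∑ i, sign i * cauchyIntegral (P.side i).2 w =
      (Subtype.val '' P.D).indicator (fun _ => 2 * Real.pi * Complex.I) w := by
  have h1 := P.bounds w fun j => ⟨hw (j, 0), hw (j, 1), hw (j, 2), hw (j, 3)⟩
  have h2 : ∑ i, sign i * cauchyIntegral (P.side i).2 w =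
      2 * Real.pi * Complex.I * (Subtype.val '' P.D).indicator 1 w := by
    rw [← h1, mul_inv_cancel_left₀ Complex.two_pi_I_ne_zero, Fintype.sum_prod_type]
    refine Finset.sum_congr rfl fun j _ => ?_
    rw [Fin.sum_univ_four]
    simp only [sign, side, cauchyIntegral, Matrix.cons_val]
    ring
  rw [h2]
  by_cases hD : w ∈ Subtype.val '' P.D
  · rw [indicator_of_mem hD, indicator_of_mem hD, Pi.one_apply, mul_one]
  · rw [indicator_of_notMem hD, indicator_of_notMem hD, mul_zero]

/-- Stokes' formula for `⟨h, f⟩ dz` with `f = ∫_{z₀} k dz`; the side pairings turn the boundary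
integral into the Fox derivatives of the relator. -/
theorem integrableOn_and_integral_eq {B : V →ₗ[ℂ] V →ₗ⋆[ℂ] ℂ}
    (hB : ∀ γ v w, B (σ γ v) (σ γ w) = B v w) (h k : S.holomorphicForms σ) :
    IntegrableOn (fun z : S.Y => B (h.1 z) (k.1 z)) P.D S.area ∧
      2 * Complex.I * ∫ z in P.D, B (h.1 z) (k.1 z) ∂S.area =
        -∑ j : Fin g,
          (B (S.periodCocycle σ P.z₀ h (SurfaceGroup.α j))
              (extendZ (S.periodCocycle σ P.z₀ k) (sharp (foxα j))) +
            B (S.periodCocycle σ P.z₀ h (SurfaceGroup.β j))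
              (extendZ (S.periodCocycle σ P.z₀ k) (sharp (foxβ j)))) := by
  have hDY : Subtype.val '' P.D ⊆ (S.Y : Set ℂ) := by
    rintro _ ⟨z, -, rfl⟩
    exact z.2
  have hdiff : DifferentiableOn ℂ (fun z => S.primitive k z - S.primitive k P.z₀) S.Y :=
    fun z hz =>
      ((S.hasDerivAt_primitive k ⟨z, hz⟩).differentiableAt.sub_const _).differentiableWithinAt
  have key := integrableOn_and_sum_curveIntegral_eq S.Y.isOpen hDY P.contDiffOn_side
    P.range_side_subset P.sum_cauchyIntegral_side
    (contDiffOn_sesquilinear B S.Y.isOpen h.2.1 hdiff)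
  rw [← integrableOn_area_iff, ← setIntegral_area] at key
  have hwb : ∀ z : S.Y,
      wirtingerBar (fun z => B (h.1 z) (S.primitive k z - S.primitive k P.z₀)) z =
        B (h.1 z) (k.1 z) := fun z =>
    wirtingerBar_sesquilinear B
      ((h.2.1.differentiableAt (S.Y.isOpen.mem_nhds z.2)).hasDerivAt)
      ((S.hasDerivAt_primitive k z).sub_const _)
  simp only [hwb] at key
  refine ⟨key.1, key.2.symm.trans ?_⟩
  rw [Fintype.sum_prod_type, ← Finset.sum_neg_distrib]
  refine Finset.sum_congr rfl fun j _ => ?_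
  rw [Fin.sum_univ_four]
  simp only [sign, side, Matrix.cons_val]
  rw [curveIntegral_translate_sesquilinear hB h k P.z₀ _ (P.a_contDiff j),
    curveIntegral_translate_sesquilinear hB h k P.z₀ _ (P.b_contDiff j),
    curveIntegral_translate_sesquilinear hB h k P.z₀ _ (P.a_contDiff j),
    curveIntegral_translate_sesquilinear hB h k P.z₀ _ (P.b_contDiff j),
    foxα, foxβ, extendZ_sharp, extendZ_sharp, map_sub, map_sub]
  change _ = -(B (S.integral h P.z₀ (SurfaceGroup.α j • P.z₀)) _ -
    B (S.integral h P.z₀ (SurfaceGroup.α j • P.z₀)) _ +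
    (B (S.integral h P.z₀ (SurfaceGroup.β j • P.z₀)) _ -
      B (S.integral h P.z₀ (SurfaceGroup.β j • P.z₀)) _))
  ring

end FundamentalPolygon

end UniformizedSurface

end Polygon

/-! ### Independence of the fundamental domain -/

section Invariance

open Set

theorem det_restrictScalars_toSpanSingleton (a : ℂ) :
    ((ContinuousLinearMap.toSpanSingleton ℂ a).restrictScalars ℝ : ℂ →L[ℝ] ℂ).det =
      Complex.normSq a := by
  have h : ((ContinuousLinearMap.toSpanSingleton ℂ a).restrictScalars ℝ : ℂ →L[ℝ] ℂ).det =
      LinearMap.det ((LinearMap.toSpanSingleton ℂ ℂ a).restrictScalars ℝ) := rfl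
  rw [h, LinearMap.det_restrictScalars, LinearMap.det_ring, Algebra.norm_complex_apply]
  simp

variable {V : Type} [NormedAddCommGroup V] [NormedSpace ℂ V]
variable {g : ℕ} {X : Type*} [TopologicalSpace X] [ChartedSpace ℂ X]

theorem SurfaceGroup.countable (g : ℕ) : Countable (SurfaceGroup g) := by
  have h1 : Countable (FreeGroup (Fin g ⊕ Fin g)) :=
    (Quot.mk_surjective (r := FreeGroup.Red.Step (α := Fin g ⊕ Fin g))).countable
  exact (PresentedGroup.mk_surjective {surfaceRelator g}).countable

namespace UniformizedSurface

variable {S : UniformizedSurface g X} {σ : Representation ℂ (SurfaceGroup g) V}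

theorem deriv_deck_ne_zero (γ : SurfaceGroup g) (z : S.Y) : deriv (S.deck γ) z ≠ 0 := by
  have h1 := S.hasDerivAt_deck γ z
  have h2 := S.hasDerivAt_deck γ⁻¹ (γ • z)
  rw [← S.deck_coe] at h2
  have h3 := h2.comp (z : ℂ) h1
  have h4 : S.deck γ⁻¹ ∘ S.deck γ =ᶠ[𝓝 (z : ℂ)] id := by
    filter_upwards [S.Y.isOpen.mem_nhds z.2] with w hw
    have := S.deck_coe γ⁻¹ (γ • ⟨w, hw⟩)
    rwa [inv_smul_smul, ← S.deck_coe] at this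
  have h5 := h3.unique ((hasDerivAt_id (z : ℂ)).congr_of_eventuallyEq h4)
  exact right_ne_zero_of_mul_eq_one h5

theorem setLIntegral_area (f : ℂ → ENNReal) (D : Set S.Y) :
    ∫⁻ z in D, f z ∂S.area = ∫⁻ z in Subtype.val '' D, f z := by
  rw [← restrict_map_area, measurableEmbedding_val.restrict_map,
    measurableEmbedding_val.lintegral_map, preimage_image_eq _ Subtype.val_injective]

theorem sigmaFinite_area (S : UniformizedSurface g X) : SigmaFinite S.area := by
  refine SigmaFinite.of_map S.area (f := Subtype.val) measurable_subtype_coe.aemeasurable ?_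
  rw [area, measurableEmbedding_val.map_comap]
  infer_instance

instance : ContinuousConstSMul (SurfaceGroup g) S.Y := S.covering.toContinuousConstSMul

/-- A density `p dx dy` with `p(γ z) |γ'(z)|² = p(z)` is an invariant measure on `Y`. -/
theorem smulInvariantMeasure_withDensity {p : ℂ → ENNReal}
    (hp : ∀ (γ : SurfaceGroup g) (z : S.Y),
      ENNReal.ofReal (Complex.normSq (deriv (S.deck γ) z)) * p (γ • z : S.Y) = p z) :
    SMulInvariantMeasure (SurfaceGroup g) S.Y (S.area.withDensity fun z => p z) := by
  refine ⟨fun γ s hs => ?_⟩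
  have hm : MeasurableSet ((γ • ·) ⁻¹' s : Set S.Y) :=
    (continuous_const_smul γ).measurable hs
  rw [withDensity_apply _ hm, withDensity_apply _ hs, setLIntegral_area, setLIntegral_area]
  have himg : Subtype.val '' s = S.deck γ '' (Subtype.val '' ((γ • ·) ⁻¹' s : Set S.Y)) := by
    ext w
    constructor
    · rintro ⟨z, hz, rfl⟩
      refine ⟨_, ⟨γ⁻¹ • z, by simpa using hz, rfl⟩, ?_⟩
      rw [S.deck_coe, smul_inv_smul]
    · rintro ⟨_, ⟨z, hz, rfl⟩, rfl⟩
      exact ⟨γ • z, hz, (S.deck_coe γ z).symm⟩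
  have hm' := measurableEmbedding_val.measurableSet_image.2 hm
  rw [himg, lintegral_image_eq_lintegral_abs_det_fderiv_mul volume hm' (f' := fun z =>
    (ContinuousLinearMap.toSpanSingleton ℂ (deriv (S.deck γ) z)).restrictScalars ℝ)]
  · refine (setLIntegral_congr_fun hm' ?_).symm
    rintro _ ⟨z, -, rfl⟩
    simp only [det_restrictScalars_toSpanSingleton, abs_of_nonneg (Complex.normSq_nonneg _)]
    rw [S.deck_coe, hp]
  · rintro _ ⟨z, -, rfl⟩
    exact ((S.hasDerivAt_deck γ z).hasFDerivAt.restrictScalars ℝ).hasFDerivWithinAt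
  · rintro _ ⟨z, -, rfl⟩ _ ⟨w, -, rfl⟩ hzw
    rw [S.deck_coe, S.deck_coe] at hzw
    rw [smul_left_cancel γ (Subtype.val_injective hzw)]

/-- For an invariant form `B`, the function `⟨h, k⟩` is an automorphic density. -/
theorem normSq_deriv_mul_form {B : V →ₗ[ℂ] V →ₗ⋆[ℂ] ℂ}
    (hB : ∀ γ v w, B (σ γ v) (σ γ w) = B v w) (h k : S.holomorphicForms σ)
    (γ : SurfaceGroup g) (z : S.Y) :
    (Complex.normSq (deriv (S.deck γ) z) : ℂ) *
      B (h.1 (γ • z : S.Y)) (k.1 (γ • z : S.Y)) = B (h.1 z) (k.1 z) := by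
  rw [← hB γ (h.1 z), ← h.2.2.2 γ z, ← k.2.2.2 γ z, map_smul B, map_smulₛₗ, LinearMap.smul_apply,
    smul_eq_mul, smul_eq_mul, Complex.normSq_eq_conj_mul_self]
  ring

variable [FiniteDimensional ℂ V]

/-- The integral of `⟨h, k⟩` does not depend on the fundamental domain. The measure with density
`⟨h, h⟩ + ⟨k, k⟩` is invariant, and relative to it `⟨h, k⟩` is an invariant function. -/
theorem integrableOn_iff_and_setIntegral_eq {B : V →ₗ[ℂ] V →ₗ⋆[ℂ] ℂ}
    (hB : ∀ γ v w, B (σ γ v) (σ γ w) = B v w) (hpos : ∀ v, v ≠ 0 → 0 < (B v v).re)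
    (h k : S.holomorphicForms σ) {D D' : Set S.Y}
    (hD : IsFundamentalDomain (SurfaceGroup g) D S.area)
    (hD' : IsFundamentalDomain (SurfaceGroup g) D' S.area) :
    (IntegrableOn (fun z : S.Y => B (h.1 z) (k.1 z)) D S.area ↔
      IntegrableOn (fun z : S.Y => B (h.1 z) (k.1 z)) D' S.area) ∧
    ∫ z in D, B (h.1 z) (k.1 z) ∂S.area = ∫ z in D', B (h.1 z) (k.1 z) ∂S.area := by
  have := SurfaceGroup.countable g
  have := S.sigmaFinite_area
  have hpos' : ∀ v, 0 ≤ (B v v).re := fun v => by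
    by_cases hv : v = 0
    · simp [hv]
    · exact (hpos v hv).le
  let d : ℂ → ℝ := fun z => (B (h.1 z) (h.1 z)).re + (B (k.1 z) (k.1 z)).re
  have hd0 : ∀ z, 0 ≤ d z := fun z => add_nonneg (hpos' _) (hpos' _)
  let p : ℂ → NNReal := fun z => (d z).toNNReal
  have hd : ∀ (γ : SurfaceGroup g) (z : S.Y),
      Complex.normSq (deriv (S.deck γ) z) * d (γ • z : S.Y) = d z := by
    intro γ z
    have h1 := congrArg Complex.re (normSq_deriv_mul_form hB h h γ z)
    have h2 := congrArg Complex.re (normSq_deriv_mul_form hB k k γ z)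
    rw [Complex.re_ofReal_mul] at h1 h2
    simp only [d, mul_add, h1, h2]
  have hdc : Continuous fun z : S.Y => d z := by
    have h1 := (contDiffOn_sesquilinear B S.Y.isOpen h.2.1 h.2.1).continuousOn
    have h2 := (contDiffOn_sesquilinear B S.Y.isOpen k.2.1 k.2.1).continuousOn
    exact (Complex.continuous_re.comp (continuousOn_iff_continuous_domRestrict.1 h1)).add
      (Complex.continuous_re.comp (continuousOn_iff_continuous_domRestrict.1 h2))
  have hpm : Measurable fun z : S.Y => p z := hdc.measurable.real_toNNReal
  let ν : Measure S.Y := S.area.withDensity fun z => p z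
  have hν : SMulInvariantMeasure (SurfaceGroup g) S.Y ν := by
    refine smulInvariantMeasure_withDensity (p := fun z => p z) fun γ z => ?_
    change ENNReal.ofReal _ * ENNReal.ofReal _ = ENNReal.ofReal _
    rw [← ENNReal.ofReal_mul (Complex.normSq_nonneg _), hd]
  have hνD := hD.mono (withDensity_absolutelyContinuous S.area fun z => (p z : ENNReal))
  have hνD' := hD'.mono (withDensity_absolutelyContinuous S.area fun z => (p z : ENNReal))
  -- Where `d` vanishes, so do `h` and `k`, and the value `0 / 0 = 0` is the right one.
  let q : S.Y → ℂ := fun z => B (h.1 z) (k.1 z) / d z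
  have hq : ∀ (γ : SurfaceGroup g) (z : S.Y), q (γ • z) = q z := by
    intro γ z
    have h1 : (Complex.normSq (deriv (S.deck γ) z) : ℂ) ≠ 0 := by
      rw [Complex.ofReal_ne_zero]
      exact fun h => deriv_deck_ne_zero γ z (Complex.normSq_eq_zero.1 h)
    simp only [q]
    rw [← normSq_deriv_mul_form hB h k γ z, ← hd γ z, Complex.ofReal_mul,
      mul_div_mul_left _ _ h1]
  have hpq : ∀ z : S.Y, p z • q z = B (h.1 z) (k.1 z) := by
    intro z
    have h1 : p z • q z = (d z : ℂ) * q z := by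
      rw [NNReal.smul_def, Real.coe_toNNReal _ (hd0 z), Complex.real_smul]
    rw [h1]
    by_cases hz : d z = 0
    · have h2 : h.1 z = 0 := by
        by_contra h3
        exact ne_of_gt (add_pos_of_pos_of_nonneg (hpos _ h3) (hpos' (k.1 z))) hz
      simp [hz, h2]
    · exact mul_div_cancel₀ _ (Complex.ofReal_ne_zero.2 hz)
  have hi : ∀ A : Set S.Y, IntegrableOn q A ν ↔
      IntegrableOn (fun z : S.Y => B (h.1 z) (k.1 z)) A S.area := by
    intro A
    rw [IntegrableOn, restrict_withDensity', integrable_withDensity_iff_integrable_smul hpm]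
    simp only [hpq, IntegrableOn]
  have hs : ∀ A : Set S.Y, ∫ z in A, q z ∂ν = ∫ z in A, B (h.1 z) (k.1 z) ∂S.area := by
    intro A
    rw [restrict_withDensity', integral_withDensity_eq_integral_smul hpm]
    simp only [hpq]
  rw [← hi, ← hi, ← hs, ← hs]
  exact ⟨hνD.integrableOn_iff hνD' hq, hνD.setIntegral_eq hνD' hq⟩

end UniformizedSurface

end Invariance

/-! ### Periods and the Hermitian product -/

section Unitarity

variable {V : Type} [NormedAddCommGroup V] [NormedSpace ℂ V]
variable {g : ℕ} {X : Type*} [TopologicalSpace X] [ChartedSpace ℂ X]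

namespace UniformizedSurface

variable {S : UniformizedSurface g X} {σ : Representation ℂ (SurfaceGroup g) V}

theorem hermitianProduct_eq (B : V →ₗ[ℂ] V →ₗ⋆[ℂ] ℂ) (D : Set S.Y) (h k : ℂ → V) :
    S.hermitianProduct B D h k = 2 * ∫ z in D, B (h z) (k z) ∂S.area := by
  rw [hermitianProduct, integral_mul_const]
  linear_combination (-2 * ∫ z in D, B (h z) (k z) ∂S.area) * Complex.I_mul_I

variable [FiniteDimensional ℂ V]

/-- Moving the base point changes the period cocycle by a coboundary. -/
theorem periodMap_eq_periodMap (y z : S.Y) (h : S.holomorphicForms σ) :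
    S.periodMap σ y h = S.periodMap σ z h := by
  refine (groupCohomology.H1π_eq_iff (A := Rep.of σ) (S.periodCocycle σ y h)
    (S.periodCocycle σ z h)).2 ⟨S.integral h z y, funext fun γ => ?_⟩
  change σ γ (S.integral h z y) - S.integral h z y =
    S.integral h y (γ • y) - S.integral h z (γ • z)
  rw [← S.integral_smul]
  simp only [integral]
  abel

/-- Unitarity of the period map for a flat bundle with an invariant Hermitian inner product. -/
theorem integrableOn_and_hermitianProduct_eq (P : S.FundamentalPolygon)
    {B : V →ₗ[ℂ] V →ₗ⋆[ℂ] ℂ} (hB : ∀ γ v w, B (σ γ v) (σ γ w) = B v w)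
    (hsymm : ∀ v w, B v w = starRingEnd ℂ (B w v)) (hpos : ∀ v, v ≠ 0 → 0 < (B v v).re)
    (y : S.Y) (h k : S.holomorphicForms σ) {D : Set S.Y}
    (hD : IsFundamentalDomain (SurfaceGroup g) D S.area) :
    IntegrableOn (fun z : S.Y => B (h.1 z) (k.1 z)) D S.area ∧
      S.hermitianProduct B D h.1 k.1 =
        cohomologyPairing B (S.periodMap σ y h) (S.periodMap σ y k) := by
  have hind := integrableOn_iff_and_setIntegral_eq hB hpos h k hD P.isFundamentalDomain
  refine ⟨hind.1.2 (P.integrableOn_and_integral_eq hB h k).1, ?_⟩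
  have hpair : cohomologyPairing B (S.periodMap σ y h) (S.periodMap σ y k) =
      cocyclePairing B (S.periodCocycle σ P.z₀ h) (S.periodCocycle σ P.z₀ k) := by
    rw [periodMap_eq_periodMap y P.z₀, periodMap_eq_periodMap y P.z₀]
    exact cohomologyPairing_mk hB _ _
  have hconj : ∫ z in P.D, B (h.1 z) (k.1 z) ∂S.area =
      starRingEnd ℂ (∫ z in P.D, B (k.1 z) (h.1 z) ∂S.area) := by
    rw [← integral_conj]
    exact integral_congr_ae (.of_forall fun z => hsymm _ _)
  -- Stokes' formula has the primitive in the second slot, the pairing has it in the first.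
  have hst := congrArg (starRingEnd ℂ) (P.integrableOn_and_integral_eq hB k h).2
  simp only [map_mul, map_neg, map_sum, map_add, ← hsymm, ← hconj, Complex.conj_I,
    map_ofNat] at hst
  rw [hermitianProduct_eq, hind.2, hpair, cocyclePairing]
  linear_combination Complex.I * hst + (2 * ∫ z in P.D, B (h.1 z) (k.1 z) ∂S.area) *
    Complex.I_mul_I

end UniformizedSurface

end Unitarity

theorem mainTheorem7 {g : ℕ} (hg : 2 ≤ g)
    {X : Type*} [TopologicalSpace X] [T2Space X] [CompactSpace X] [ConnectedSpace X]
    [ChartedSpace ℂ X] [IsManifold 𝓘(ℂ) ω X]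
    (S : UniformizedSurface g X) (P : S.FundamentalPolygon)
    {n : ℕ} (G K : Subgroup (GL (Fin n) ℂ)) (hG : IsConnectedReductive G)
    (hK : IsMaximalCompact G K) (B : InvariantHermitian G K)
    (ρ : SurfaceGroup g →* G) (hunitary : ∀ γ, (ρ γ : GL (Fin n) ℂ) ∈ K) (hgood : IsGoodRep G ρ)
    (y : S.Y) (ω₁ ω₂ : S.holomorphicForms (adRep ρ))
    (D : Set S.Y) (hD : IsFundamentalDomain (SurfaceGroup g) D S.area) :
    IntegrableOn (fun z : S.Y => B.form (ω₁.1 z) (ω₂.1 z)) D S.area ∧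
      S.hermitianProduct B.form D ω₁.1 ω₂.1 =
        cohomologyPairing B.form (S.periodMap (adRep ρ) y ω₁) (S.periodMap (adRep ρ) y ω₂) :=
  UniformizedSurface.integrableOn_and_hermitianProduct_eq P
    (fun γ => B.invariant (ρ γ) (hunitary γ)) B.conj_symm B.pos_def y ω₁ ω₂ hD
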